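/- A GF(2)-grammar over an alphabet $\Sigma$ is given by a set $N$ of nonterminal symbols, an initial symbol $S \in N$ and a finite set of rules $A \to X_1 \odot \cdots \odot X_\ell$ ($\ell \ge 0$, $A \in N$, $X_i \in \Sigma \cup N$), such that in the corresponding ordinary context-free grammar with rules $A \to X_1 \cdots X_\ell$ every word $w \in \Sigma^*$ has only finitely many parse trees. The language described by it is the set of all words $w \in \Sigma^*$ that have an odd number of parse trees (with root $S$) in the corresponding ordinary grammar. **Theorem.** Let $a, b, c$ be three distinct letters of an alphabet $\Sigma$. No GF(2)-grammar over $\Sigma$ describes the language $\{a^n b^n c^n \mid n \ge 0\}$. Moreover, let $R_{a,b,c}$ be the set of all elements of $\mathbb{F}_2((a,b,c))$, the field of fractions of $\mathbb{F}_2[[a,b,c]]$, that can be represented as $$\frac{\sum_{i=1}^n A_i B_i C_i}{p\,q\,r},$$ where $n \ge 0$; $A_i \in \mathbb{F}_2[[a]]$, $B_i \in \mathbb{F}_2[[b]]$, $C_i \in \mathbb{F}_2[[c]]$ are power series algebraic over $\mathbb{F}_2[a]$, $\mathbb{F}_2[b]$, $\mathbb{F}_2[c]$ respectively; and $p \in \mathbb{F}_2[a,b]$,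 $q \in \mathbb{F}_2[a,c]$, $r \in \mathbb{F}_2[b,c]$ are non-zero polynomials. Then $(1+abc)^{-1} \notin R_{a,b,c}$. -/

import Mathlib

/-! ### Parse trees and GF(2)-grammars -/

/-- `ParseForest g α` is the type of ordered sequences of parse trees of the ordinary
(context-free) grammar `g` whose roots, read from left to right, are labelled by the symbols of
`α`.  A tree whose root is a terminal is a single leaf.  A tree whose root is a nonterminal `A`
consists of a rule `A → β` of `g` and of a sequence of subtrees with roots `β`. -/
inductive ParseForest {T : Type*} (g : ContextFreeGrammar T) : List (Symbol T g.NT) → Type _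
  /-- The empty sequence of trees. -/
  | nil : ParseForest g []
  /-- A leaf labelled by the terminal `t`, followed by further trees. -/
  | leaf (t : T) {α : List (Symbol T g.NT)} (rest : ParseForest g α) :
      ParseForest g (Symbol.terminal t :: α)
  /-- A tree with root `A`, to which the rule `A → β` is applied, followed by further trees. -/
  | node (A : g.NT) (β : List (Symbol T g.NT)) (mem : ContextFreeRule.mk A β ∈ g.rules)
      (children : ParseForest g β) {α : List (Symbol T g.NT)} (rest : ParseForest g α) :
      ParseForest g (Symbol.nonterminal A :: α)

/-- The word that is spelled by the leaves of a sequence of parse trees, from left to right. -/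
def ParseForest.yield {T : Type*} {g : ContextFreeGrammar T} :
    {α : List (Symbol T g.NT)} → ParseForest g α → List T
  | _, .nil => []
  | _, .leaf t rest => t :: rest.yield
  | _, .node _ _ _ children rest => children.yield ++ rest.yield

/-- The set of parse trees of the word `w` in the ordinary grammar `g`, that is, of the trees with
yield `w` whose root is the initial symbol of `g`. -/
def ContextFreeGrammar.parseTrees {T : Type*} (g : ContextFreeGrammar T) (w : List T) :
    Set (ParseForest g [Symbol.nonterminal g.initial]) :=
  {t | t.yield = w}

/-- A GF(2)-grammar over the alphabet `T`: its nonterminals, its rules and its initial symbol are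
those of an ordinary grammar, in which every word has only finitely many parse trees. -/
structure GF2Grammar (T : Type*) where
  /-- The corresponding ordinary grammar. -/
  ordinary : ContextFreeGrammar T
  /-- Every word has a finite number of parse trees. -/
  finite_parseTrees : ∀ w : List T, (ordinary.parseTrees w).Finite

/-- The language described by a GF(2)-grammar: the set of all words with an odd number of parse
trees in the corresponding ordinary grammar. -/
def GF2Grammar.language {T : Type*} (G : GF2Grammar T) : Language T :=
  {w | Odd (G.ordinary.parseTrees w).ncard}

/-- The language `{aⁿ bⁿ cⁿ | n ≥ 0}`. -/
def languageANBNCN {T : Type*} (a b c : T) : Language T :=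
  {w | ∃ n : ℕ, w = List.replicate n a ++ List.replicate n b ++ List.replicate n c}

/-! ### The set `R_{a,b,c}` of Laurent series

The variables `a`, `b`, `c` are indexed by `0`, `1`, `2` in `Fin 3`.  Laurent series are fractions
of formal power series. -/

/-- The set of those power series in `F₂[[a, b, c]]` that are algebraic power series in the single
variable with index `i`: the images, under the substitution of that variable for `t`, of the
series in `F₂[[t]]` that are algebraic over `F₂[t]`. -/
def algebraicSeriesIn (i : Fin 3) : Set (MvPowerSeries (Fin 3) (ZMod 2)) :=
  {f | ∃ g : PowerSeries (ZMod 2), IsAlgebraic (Polynomial (ZMod 2)) g ∧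
    f = MvPowerSeries.rename (fun _ : Unit => i) g}

/-- The set of all Laurent series of the form `(∑ Aᵢ Bᵢ Cᵢ) / (p q r)`, where the sum is finite,
`Aᵢ`, `Bᵢ`, `Cᵢ` are algebraic power series in `a`, in `b` and in `c`, and `p`, `q`, `r` are
non-zero polynomials in `a, b`, in `a, c` and in `b, c`. -/
def Rabc : Set (FractionRing (MvPowerSeries (Fin 3) (ZMod 2))) :=
  {f | ∃ (n : ℕ) (A B C : Fin n → MvPowerSeries (Fin 3) (ZMod 2))
      (p q r : MvPolynomial (Fin 3) (ZMod 2)),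
    (∀ i, A i ∈ algebraicSeriesIn 0) ∧ (∀ i, B i ∈ algebraicSeriesIn 1) ∧
    (∀ i, C i ∈ algebraicSeriesIn 2) ∧
    p ∈ MvPolynomial.supported (ZMod 2) {0, 1} ∧ q ∈ MvPolynomial.supported (ZMod 2) {0, 2} ∧
    r ∈ MvPolynomial.supported (ZMod 2) {1, 2} ∧ p ≠ 0 ∧ q ≠ 0 ∧ r ≠ 0 ∧
    f = algebraMap (MvPowerSeries (Fin 3) (ZMod 2)) _ (∑ i, A i * B i * C i) /
      algebraMap (MvPowerSeries (Fin 3) (ZMod 2)) _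
        ((p * q * r : MvPolynomial (Fin 3) (ZMod 2)) : MvPowerSeries (Fin 3) (ZMod 2))}

/-! ### The diagonal series -/

/-! Write `D = ∑ (abc)ⁿ`, the inverse of `1 - abc` (which is `1 + abc` over `ZMod 2`). The core is
`mul_diagonalSeries_notMem_separatedSpan`: `p q r D` is never a finite sum of products `A B C` of
univariate power series, algebraic or not. In such a sum the coefficients, arranged as a matrix with
rows indexed by the exponents of `a, b` and columns by the exponent of `c`, have finite rank. Far
from the origin, however, the coefficients of `p q r D` depend only on the exponent modulo
`(1,1,1)`; they are those of the image `H` of `p q r` in `k[a,b,c]/(1 - abc)`, a Laurent polynomial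
ring. Each of `p, q, r` misses a variable, so its image is non-zero, and `H ≠ 0` because this ring
is a domain. An extreme term of `H` then gives triangular submatrices of any size with non-zero
diagonal.

For a grammar, the numbers of parse trees solve a polynomial system over series of words. Finiteness
makes the dependence of the constant terms acyclic (`regularSystem`). A series of words is sent to
an upper triangular 3×3 matrix, whose entry `(s, t)` collects the sorted words leading an automaton
for `a* b* c*` from state `s` to state `t`; this map is multiplicative (`sortedSeries_wordConv`).
The diagonal entries are univariate and solve a polynomial system with non-singular Jacobian, hence
are algebraic (`isAlgebraic_of_jacobian_ne_zero`). The entries above the diagonal solve linear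
systems over algebras generated by these, with determinant non-zero by acyclicity and dividing a
polynomial in two variables (`exists_mul_eq_polynomial`). Cramer's rule therefore bounds the
denominator of the entry `(0, 2)` by some `p q r` (`exists_mul_sortedSeries_zero_two_mem`). For the
language `aⁿ bⁿ cⁿ` this entry is `D - 1`, which contradicts the core. -/

/-- The power series `∑ₙ (abc)ⁿ`. -/
def diagonalSeries (k : Type*) [CommRing k] : MvPowerSeries (Fin 3) k :=
  fun m => if m 0 = m 1 ∧ m 1 = m 2 then 1 else 0

theorem coeff_diagonalSeries {k : Type*} [CommRing k] (m : Fin 3 →₀ ℕ) :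
    MvPowerSeries.coeff m (diagonalSeries k) = if m 0 = m 1 ∧ m 1 = m 2 then 1 else 0 := rfl

theorem X_mul_X_mul_X_eq_monomial (k : Type*) [CommRing k] :
    (MvPowerSeries.X 0 * MvPowerSeries.X 1 * MvPowerSeries.X 2 : MvPowerSeries (Fin 3) k) =
      MvPowerSeries.monomial (Finsupp.equivFunOnFinite.symm 1) 1 := by
  rw [MvPowerSeries.X, MvPowerSeries.X, MvPowerSeries.X, MvPowerSeries.monomial_mul_monomial,
    MvPowerSeries.monomial_mul_monomial]
  have h : (Finsupp.single 0 1 + Finsupp.single 1 1 + Finsupp.single 2 1 : Fin 3 →₀ ℕ) =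
      Finsupp.equivFunOnFinite.symm 1 := by
    ext i
    fin_cases i <;> simp
  rw [h, mul_one, mul_one]

theorem one_sub_mul_diagonalSeries (k : Type*) [CommRing k] :
    (1 - MvPowerSeries.X 0 * MvPowerSeries.X 1 * MvPowerSeries.X 2) * diagonalSeries k = 1 := by
  ext m
  rw [X_mul_X_mul_X_eq_monomial, sub_mul, one_mul, map_sub, MvPowerSeries.coeff_monomial_mul,
    MvPowerSeries.coeff_one, coeff_diagonalSeries, coeff_diagonalSeries]
  have hle : Finsupp.equivFunOnFinite.symm 1 ≤ m ↔ 1 ≤ m 0 ∧ 1 ≤ m 1 ∧ 1 ≤ m 2 := by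
    rw [Finsupp.le_def]
    simp [Fin.forall_fin_succ]
  have h0 : m = 0 ↔ m 0 = 0 ∧ m 1 = 0 ∧ m 2 = 0 := by
    rw [Finsupp.ext_iff]
    simp [Fin.forall_fin_succ]
  simp only [hle, h0, Finsupp.coe_tsub, Pi.sub_apply, Finsupp.equivFunOnFinite_symm_apply_apply,
    Pi.one_apply, one_mul]
  by_cases h : m 0 = m 1 ∧ m 1 = m 2
  · obtain ⟨h1, h2⟩ := h
    rcases Nat.eq_zero_or_pos (m 2) with h3 | h3
    · simp [h1, h2, h3]
    · simp [h1, h2, Nat.one_le_iff_ne_zero, h3.ne']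
  · by_cases h' : 1 ≤ m 0 ∧ 1 ≤ m 1 ∧ 1 ≤ m 2
    · rw [if_neg h, if_pos h', if_neg (by omega), if_neg (by omega), sub_zero]
    · rw [if_neg h, if_neg h', if_neg (by omega), sub_zero]

/-! ### Reduction modulo `1 - abc`. -/

/-- The class of an exponent vector modulo translations by `(1, 1, 1)`. -/
def exponentClass (m : Fin 3 →₀ ℕ) : ℤ × ℤ := ((m 0 : ℤ) - m 2, (m 1 : ℤ) - m 2)

/-- Reduction of polynomials modulo `1 - abc`, with values in Laurent polynomials. -/
noncomputable def reduceDiagonal (k : Type*) [CommRing k] :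
    MvPolynomial (Fin 3) k →ₐ[k] AddMonoidAlgebra k (ℤ × ℤ) :=
  MvPolynomial.aeval ![AddMonoidAlgebra.single (1, 0) 1, AddMonoidAlgebra.single (0, 1) 1,
    AddMonoidAlgebra.single (-1, -1) 1]

theorem reduceDiagonal_monomial {k : Type*} [CommRing k] (m : Fin 3 →₀ ℕ) (x : k) :
    reduceDiagonal k (MvPolynomial.monomial m x) =
      AddMonoidAlgebra.single (exponentClass m) x := by
  rw [reduceDiagonal, MvPolynomial.aeval_monomial, Finsupp.prod_fintype _ _ (by simp),
    Fin.prod_univ_three]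
  simp only [Matrix.cons_val_zero, Matrix.cons_val_one, Matrix.cons_val,
    AddMonoidAlgebra.single_pow, AddMonoidAlgebra.single_mul_single, one_pow, mul_one,
    AddMonoidAlgebra.coe_algebraMap, Function.comp_apply, Algebra.algebraMap_self,
    RingHom.id_apply, zero_add]
  congr 1
  ext <;> simp [exponentClass] <;> ring

theorem coeff_reduceDiagonal {k : Type*} [CommRing k] (p : MvPolynomial (Fin 3) k) (z : ℤ × ℤ) :
    (reduceDiagonal k p).coeff z =
      ∑ m ∈ p.support, if exponentClass m = z then p.coeff m else 0 := by
  conv_lhs => rw [p.as_sum, map_sum]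
  simp only [reduceDiagonal_monomial, AddMonoidAlgebra.coeff_sum, AddMonoidAlgebra.coeff_single,
    Finsupp.finsetSum_apply, Finsupp.single_apply]

/-- No cancellation can occur: all exponents of `p` vanish at a common coordinate `j`, and two
vectors that differ by a multiple of `(1,1,1)` and agree at `j` are equal. -/
theorem reduceDiagonal_ne_zero {k : Type*} [CommRing k] {p : MvPolynomial (Fin 3) k} (hp : p ≠ 0)
    {s : Set (Fin 3)} (hs : s ≠ Set.univ) (hps : p ∈ MvPolynomial.supported k s) :
    reduceDiagonal k p ≠ 0 := by
  obtain ⟨j, hj⟩ := (Set.ne_univ_iff_exists_notMem s).mp hs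
  have hzero : ∀ m ∈ p.support, m j = 0 := by
    intro m hm
    by_contra hmj
    exact hj (MvPolynomial.mem_supported.mp hps
      (MvPolynomial.mem_vars_iff_mem_support j |>.mpr ⟨m, hm, Finsupp.mem_support_iff.mpr hmj⟩))
  obtain ⟨m, hm⟩ := MvPolynomial.support_nonempty.mpr hp
  intro h
  have hcoeff := coeff_reduceDiagonal p (exponentClass m)
  rw [h, Finset.sum_eq_single_of_mem m hm, if_pos rfl] at hcoeff
  · exact MvPolynomial.mem_support_iff.mp hm hcoeff.symm
  · intro m' hm' hne
    refine if_neg fun heq => hne ?_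
    have h1 := hzero m hm
    have h2 := hzero m' hm'
    simp only [exponentClass, Prod.mk.injEq] at heq
    have : m' 0 = m 0 ∧ m' 1 = m 1 ∧ m' 2 = m 2 := by
      fin_cases j <;> simp only [Fin.mk_zero, Fin.mk_one, Fin.reduceFinMk] at h1 h2 <;>
        omega
    ext i
    fin_cases i
    exacts [this.1, this.2.1, this.2.2]

/-- When `M` dominates every exponent `m` of `p`, the term at `m` contributes exactly if `M - m` is
a multiple of `(1,1,1)`, that is, if `m` and `M` are in one class. -/
theorem coeff_mul_diagonalSeries {k : Type*} [CommRing k] (p : MvPolynomial (Fin 3) k)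
    (M : Fin 3 →₀ ℕ) (hM : ∀ m ∈ p.support, m ≤ M) :
    MvPowerSeries.coeff M ((p : MvPowerSeries (Fin 3) k) * diagonalSeries k) =
      (reduceDiagonal k p).coeff (exponentClass M) := by
  have hsum : (p : MvPowerSeries (Fin 3) k) =
      ∑ m ∈ p.support, MvPowerSeries.monomial m (p.coeff m) := by
    conv_lhs => rw [p.as_sum]
    rw [← MvPolynomial.coeToMvPowerSeries.ringHom_apply, map_sum]
    simp
  rw [coeff_reduceDiagonal, hsum, Finset.sum_mul, map_sum]
  refine Finset.sum_congr rfl fun m hm => ?_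
  have h := hM m hm
  rw [MvPowerSeries.coeff_monomial_mul, if_pos h, coeff_diagonalSeries]
  have h0 := h 0
  have h1 := h 1
  have h2 := h 2
  have hiff : ((M - m) 0 = (M - m) 1 ∧ (M - m) 1 = (M - m) 2) ↔
      exponentClass m = exponentClass M := by
    simp only [Finsupp.coe_tsub, Pi.sub_apply, exponentClass, Prod.mk.injEq]
    omega
  simp only [hiff, mul_ite, mul_one, mul_zero]

/-! ### Finite rank of separated sums, and the rank argument. -/

/-- The span of all products `A B C` of a power series in `a`, one in `b` and one in `c`. -/
noncomputable def separatedSpan (k : Type*) [CommRing k] :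
    Submodule k (MvPowerSeries (Fin 3) k) :=
  Submodule.span k {f | ∃ A B C : PowerSeries k,
    f = A.toMvPowerSeries 0 * B.toMvPowerSeries 1 * C.toMvPowerSeries 2}

theorem coeff_toMvPowerSeries {σ k : Type*} [CommRing k] (i : σ)
    (f : PowerSeries k) (M : σ →₀ ℕ) :
    MvPowerSeries.coeff M (f.toMvPowerSeries i) =
      open Classical in if M = Finsupp.single i (M i) then f.coeff (M i) else 0 := by
  split_ifs with h
  · rw [h]
    have := MvPowerSeries.coeff_embDomain_rename (Function.Embedding.punit i) f
      (Finsupp.single () (M i))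
    rw [Finsupp.embDomain_single] at this
    rw [Finsupp.single_eq_same]
    exact this
  · refine MvPowerSeries.coeff_rename_eq_zero _ _ ?_
    rintro ⟨x, rfl⟩
    apply h
    rw [Finsupp.unique_single x, Finsupp.mapDomain_single, Finsupp.single_eq_same]

theorem coeff_mul_toMvPowerSeries {σ k : Type*} [CommRing k] {i : σ} {f : MvPowerSeries σ k}
    (hf : ∀ m : σ →₀ ℕ, m i ≠ 0 → MvPowerSeries.coeff m f = 0) (g : PowerSeries k) (M : σ →₀ ℕ) :
    MvPowerSeries.coeff M (f * g.toMvPowerSeries i) =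
      MvPowerSeries.coeff (M.erase i) f * g.coeff (M i) := by
  classical
  rw [MvPowerSeries.coeff_mul, Finset.sum_eq_single (M.erase i, Finsupp.single i (M i))]
  · simp [coeff_toMvPowerSeries]
  · rintro ⟨x, y⟩ hxy hne
    rw [Finset.HasAntidiagonal.mem_antidiagonal] at hxy
    simp only at hxy hne ⊢
    by_cases hx : x i = 0
    · rw [coeff_toMvPowerSeries, if_neg, mul_zero]
      intro hy
      have hMi : M i = y i := by rw [← hxy]; simp [hx]
      refine hne (Prod.ext ?_ ?_)
      · ext j
        by_cases hj : j = i
        · simp [hj, hx]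
        · rw [Finsupp.erase_ne hj, ← hxy, hy]
          simp [Ne.symm hj]
      · rw [hMi]
        exact hy
    · rw [hf x hx, zero_mul]
  · intro h
    exact absurd (Finset.HasAntidiagonal.mem_antidiagonal.mpr (Finsupp.erase_add_single i M)) h

theorem coeff_separated {k : Type*} [CommRing k] (A B C : PowerSeries k) (M : Fin 3 →₀ ℕ) :
    MvPowerSeries.coeff M
      (A.toMvPowerSeries 0 * B.toMvPowerSeries 1 * C.toMvPowerSeries (2 : Fin 3)) =
      A.coeff (M 0) * B.coeff (M 1) * C.coeff (M 2) := by
  have hA : ∀ m : Fin 3 →₀ ℕ, ∀ j ≠ 0, m j ≠ 0 →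
      MvPowerSeries.coeff m (A.toMvPowerSeries 0) = 0 := by
    intro m j hj hm
    rw [coeff_toMvPowerSeries, if_neg]
    intro h
    rw [h, Finsupp.single_eq_of_ne hj] at hm
    exact hm rfl
  have hA1 := fun m => hA m 1 (by decide)
  rw [coeff_mul_toMvPowerSeries, coeff_mul_toMvPowerSeries hA1, coeff_toMvPowerSeries, if_pos]
  · simp
  · ext j
    fin_cases j <;> simp
  · intro m hm
    rw [coeff_mul_toMvPowerSeries hA1, hA _ 2 (by decide), zero_mul]
    simpa using hm

/-- This is the rank bound: splitting off the third exponent factors the coefficient matrix through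
`Fin n`. -/
theorem exists_coeff_of_mem_separatedSpan {k : Type*} [CommRing k] {f : MvPowerSeries (Fin 3) k}
    (hf : f ∈ separatedSpan k) :
    ∃ (n : ℕ) (g : Fin n → ℕ → ℕ → k) (h : Fin n → ℕ → k), ∀ M : Fin 3 →₀ ℕ,
      MvPowerSeries.coeff M f = ∑ i, g i (M 0) (M 1) * h i (M 2) := by
  rw [separatedSpan, Submodule.mem_span_set'] at hf
  obtain ⟨n, x, s, rfl⟩ := hf
  choose A B C hs using fun i => (s i).2
  refine ⟨n, fun i u v => x i * ((A i).coeff u * (B i).coeff v), fun i w => (C i).coeff w,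
    fun M => ?_⟩
  simp only [map_sum, map_smul, hs, coeff_separated, smul_eq_mul, ← mul_assoc]

/-- An invertible matrix of size `n + 1` is found among the coefficients, against a factorization
through dimension `n`. -/
theorem mul_diagonalSeries_notMem_separatedSpan {k : Type*} [Field k]
    {p q r : MvPolynomial (Fin 3) k}
    (hp : p ∈ MvPolynomial.supported k {0, 1}) (hq : q ∈ MvPolynomial.supported k {0, 2})
    (hr : r ∈ MvPolynomial.supported k {1, 2}) (hp0 : p ≠ 0) (hq0 : q ≠ 0) (hr0 : r ≠ 0) :
    ((p * q * r : MvPolynomial (Fin 3) k) : MvPowerSeries (Fin 3) k) * diagonalSeries k ∉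
      separatedSpan k := by
  intro hmem
  obtain ⟨n, g, h, hgh⟩ := exists_coeff_of_mem_separatedSpan hmem
  have hne : reduceDiagonal k (p * q * r) ≠ 0 := by
    rw [map_mul, map_mul]
    refine mul_ne_zero (mul_ne_zero ?_ ?_) ?_
    · exact reduceDiagonal_ne_zero hp0 (by rw [Set.ne_univ_iff_exists_notMem]; exact ⟨2, by simp⟩) hp
    · exact reduceDiagonal_ne_zero hq0 (by rw [Set.ne_univ_iff_exists_notMem]; exact ⟨1, by simp⟩) hq
    · exact reduceDiagonal_ne_zero hr0 (by rw [Set.ne_univ_iff_exists_notMem]; exact ⟨0, by simp⟩) hr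
  set H := reduceDiagonal k (p * q * r) with hH
  have hsupp : H.coeff.support.Nonempty := by
    rw [Finsupp.support_nonempty_iff]
    exact fun h => hne (AddMonoidAlgebra.coeff_eq_zero.mp h)
  -- Maximality of the first coordinate makes `H` vanish at `z + (d, d)` for every `d > 0`.
  obtain ⟨z, hz, hmax⟩ := Finset.exists_max_image H.coeff.support Prod.fst hsupp
  obtain ⟨D, hD⟩ : ∃ D : ℕ, ∀ m ∈ (p * q * r).support, ∀ i, m i ≤ D := by
    refine ⟨(p * q * r).support.sup fun m => ∑ i, m i, fun m hm i => ?_⟩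
    exact (Finset.single_le_sum (f := fun i => m i) (fun _ _ => Nat.zero_le _)
      (Finset.mem_univ i)).trans (Finset.le_sup (f := fun m => ∑ i, m i) hm)
  -- This shift makes all three exponents used below at least `D`, so that
  -- `coeff_mul_diagonalSeries` applies and `toNat` truncates nothing.
  set N : ℕ := D + z.1.natAbs + z.2.natAbs with hN
  let U : Matrix (Fin (n + 1)) (Fin n) k :=
    fun s i => g i (z.1 + N + s).toNat (z.2 + N + s).toNat
  let V : Matrix (Fin n) (Fin (n + 1)) k := fun i t => h i (N + t)
  have hUV : ∀ s t : Fin (n + 1), (U * V) s t = H.coeff (z.1 + s - t, z.2 + s - t) := by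
    intro s t
    let M : Fin 3 →₀ ℕ := Finsupp.equivFunOnFinite.symm
      ![(z.1 + N + s).toNat, (z.2 + N + s).toNat, N + t]
    have hM := hgh M
    rw [coeff_mul_diagonalSeries] at hM
    · rw [Matrix.mul_apply]
      have : exponentClass M = (z.1 + s - t, z.2 + s - t) := by
        simp only [exponentClass, M, Finsupp.equivFunOnFinite_symm_apply_apply,
          Matrix.cons_val_zero, Matrix.cons_val_one, Matrix.cons_val, Prod.mk.injEq]
        omega
      rw [← this, hH, hM]
      rfl
    · intro m hm
      rw [Finsupp.le_def, Fin.forall_fin_succ, Fin.forall_fin_succ, Fin.forall_fin_succ]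
      have h0 := hD m hm 0
      have h1 := hD m hm 1
      have h2 := hD m hm 2
      simp [M]
      omega
  -- The entry at `(s, t)` is the coefficient of `H` at `z + (s - t)(1, 1)`, which is zero below the
  -- diagonal and `H.coeff z ≠ 0` on it.
  have hdet : (U * V).det = ∏ s : Fin (n + 1), (U * V) s s := by
    apply Matrix.det_of_isUpperTriangular
    intro s t hst
    rw [hUV]
    by_contra hne'
    have := hmax _ (Finsupp.mem_support_iff.mpr hne')
    have hst' : (t : ℕ) < s := hst
    simp at this
    omega
  have hunit : (U * V).det ≠ 0 := by
    rw [hdet]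
    refine Finset.prod_ne_zero_iff.mpr fun s _ => ?_
    rw [hUV]
    simpa using hz
  have h1 := Matrix.rank_of_isUnit _ ((Matrix.isUnit_iff_isUnit_det _).mpr hunit.isUnit)
  have h2 := Matrix.rank_mul_le_left U V
  have h3 := Matrix.rank_le_width U
  simp at h1
  omega

/-! ### Algebraic power series in a single variable and their denominators -/

instance (σ k : Type*) [Field k] : IsDomain (MvPowerSeries σ k) :=
  NoZeroDivisors.to_isDomain _

theorem algebraMap_polynomial_powerSeries {k : Type*} [Field k] (p : Polynomial k) :
    algebraMap (Polynomial k) (PowerSeries k) p = (p : PowerSeries k) := by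
  rw [PowerSeries.algebraMap_apply', Algebra.algebraMap_self, PowerSeries.map_id]
  rfl

/-- The algebraic power series in the single variable `i`. -/
noncomputable def univariateAlgebraic (k : Type*) [Field k] {σ : Type*} (i : σ) :
    Subalgebra k (MvPowerSeries σ k) :=
  ((Subalgebra.algebraicClosure (Polynomial k) (PowerSeries k)).restrictScalars k).map
    (PowerSeries.toMvPowerSeries i)

theorem mem_univariateAlgebraic {k : Type*} [Field k] {σ : Type*} {i : σ}
    {f : MvPowerSeries σ k} : f ∈ univariateAlgebraic k i ↔
      ∃ g : PowerSeries k, IsAlgebraic (Polynomial k) g ∧ g.toMvPowerSeries i = f :=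
  Iff.rfl

/-- The polynomials in the variables of `s`, as power series. -/
noncomputable def polynomialsIn (k : Type*) [Field k] {σ : Type*} (s : Set σ) :
    Subalgebra k (MvPowerSeries σ k) :=
  (MvPolynomial.supported k s).map (MvPolynomial.coeToMvPowerSeries.algHom k)

theorem mem_polynomialsIn {k : Type*} [Field k] {σ : Type*} {s : Set σ}
    {f : MvPowerSeries σ k} : f ∈ polynomialsIn k s ↔
      ∃ p ∈ MvPolynomial.supported k s, (p : MvPowerSeries σ k) = f := by
  simp [polynomialsIn, Subalgebra.mem_map]

theorem polynomialsIn_eq_adjoin (k : Type*) [Field k] {σ : Type*} (s : Set σ) :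
    polynomialsIn k s = Algebra.adjoin k (MvPowerSeries.X '' s) := by
  rw [polynomialsIn, MvPolynomial.supported, AlgHom.map_adjoin, Set.image_image]
  simp

theorem X_mem_univariateAlgebraic (k : Type*) [Field k] {σ : Type*} (i : σ) :
    (MvPowerSeries.X i : MvPowerSeries σ k) ∈ univariateAlgebraic k i := by
  refine mem_univariateAlgebraic.mpr ⟨PowerSeries.X, ?_, PowerSeries.toMvPowerSeries_X i⟩
  have := isAlgebraic_algebraMap (R := Polynomial k) (A := PowerSeries k) Polynomial.X
  rwa [algebraMap_polynomial_powerSeries, Polynomial.coe_X] at this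

theorem polynomialsIn_le {k : Type*} [Field k] {σ : Type*} {s : Set σ}
    {S : Subalgebra k (MvPowerSeries σ k)} (h : ∀ i ∈ s, univariateAlgebraic k i ≤ S) :
    polynomialsIn k s ≤ S := by
  rw [polynomialsIn_eq_adjoin, Algebra.adjoin_le_iff]
  rintro _ ⟨i, hi, rfl⟩
  exact h i hi (X_mem_univariateAlgebraic k i)

theorem isAlgebraic_of_mem_univariateAlgebraic {k : Type*} [Field k] {σ : Type*} {i : σ}
    {s : Set σ} (hi : i ∈ s) {f : MvPowerSeries σ k} (hf : f ∈ univariateAlgebraic k i) :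
    IsAlgebraic (polynomialsIn k s) f := by
  obtain ⟨g, hg, rfl⟩ := mem_univariateAlgebraic.mp hf
  have hX : (MvPowerSeries.X i : MvPowerSeries σ k) ∈ polynomialsIn k s := by
    rw [polynomialsIn_eq_adjoin]
    exact Algebra.subset_adjoin ⟨i, hi, rfl⟩
  let φ : Polynomial k →ₐ[k] polynomialsIn k s := Polynomial.aeval ⟨MvPowerSeries.X i, hX⟩
  have hcomp : (RingHom.comp (algebraMap (polynomialsIn k s) (MvPowerSeries σ k)) φ) =
      RingHom.comp (PowerSeries.toMvPowerSeries (R := k) i : PowerSeries k →+* MvPowerSeries σ k)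
        (algebraMap (Polynomial k) (PowerSeries k)) := by
    refine Polynomial.ringHom_ext (fun x => ?_) ?_
    · simp [φ, algebraMap_polynomial_powerSeries, MvPowerSeries.algebraMap_apply]
    · simp [φ, algebraMap_polynomial_powerSeries]
  refine IsAlgebraic.ringHom_of_comp_eq φ
    (PowerSeries.toMvPowerSeries (R := k) i : PowerSeries k →+* MvPowerSeries σ k) hg ?_ hcomp
  have : Function.Injective ((algebraMap (polynomialsIn k s) (MvPowerSeries σ k)).comp
      (φ : Polynomial k →+* polynomialsIn k s)) := by
    rw [hcomp]
    exact (PowerSeries.toMvPowerSeries_injective i).comp fun x y h => by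
      simpa [algebraMap_polynomial_powerSeries] using h
  exact fun x y h => this (by simp [show φ x = φ y from h])

/-- Take a polynomial relation for `d` with non-zero constant term and move that term to the other
side: what remains is `d` times a polynomial in `d`. -/
theorem Subalgebra.exists_mul_mem_of_isAlgebraic {k K : Type*} [Field k] [CommRing K] [IsDomain K]
    [Algebra k K] {P S : Subalgebra k K} (hPS : P ≤ S) {d : K} (hd : d ∈ S) (hd0 : d ≠ 0)
    (halg : IsAlgebraic P d) : ∃ e ∈ S, d * e ∈ P ∧ d * e ≠ 0 := by
  obtain ⟨f, hf0, hf⟩ := halg.exists_nonzero_coeff_and_aeval_eq_zero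
    (mem_nonZeroDivisors_of_ne_zero hd0)
  have h : d * Polynomial.aeval d f.divX + f.coeff 0 = 0 := by
    have := congrArg (Polynomial.aeval d) (Polynomial.divX_mul_X_add f)
    rw [hf, map_add, map_mul, Polynomial.aeval_X, Polynomial.aeval_C, mul_comm] at this
    exact this
  have h' : d * -Polynomial.aeval d f.divX = f.coeff 0 := by linear_combination -h
  refine ⟨-Polynomial.aeval d f.divX, S.neg_mem ?_, ?_⟩
  · rw [Polynomial.aeval_eq_sum_range]
    refine S.sum_mem fun n _ => ?_
    rw [Algebra.smul_def]
    exact S.mul_mem (hPS (f.divX.coeff n).2) (S.pow_mem hd n)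
  · rw [h']
    exact ⟨(f.coeff 0).2, fun h0 => hf0 (Subtype.ext h0)⟩

/-- This rationalizes denominators: division by `d` is replaced by division by a polynomial, at the
cost of a factor `e` in the same algebra. -/
theorem exists_mul_eq_polynomial {k : Type*} [Field k] {σ : Type*} {i j : σ}
    {d : MvPowerSeries σ k} (hd : d ∈ univariateAlgebraic k i ⊔ univariateAlgebraic k j)
    (hd0 : d ≠ 0) :
    ∃ e ∈ univariateAlgebraic k i ⊔ univariateAlgebraic k j,
      ∃ p ∈ MvPolynomial.supported k {i, j}, p ≠ 0 ∧ d * e = p := by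
  have hle : polynomialsIn k {i, j} ≤ univariateAlgebraic k i ⊔ univariateAlgebraic k j := by
    refine polynomialsIn_le ?_
    rintro l (rfl | rfl)
    exacts [le_sup_left, le_sup_right]
  have halg : IsAlgebraic (polynomialsIn k {i, j}) d := by
    have hsup : univariateAlgebraic k i ⊔ univariateAlgebraic k j ≤
        (Subalgebra.algebraicClosure (polynomialsIn k {i, j})
          (MvPowerSeries σ k)).restrictScalars k :=
      sup_le (fun f hf => isAlgebraic_of_mem_univariateAlgebraic (by simp) hf)
        (fun f hf => isAlgebraic_of_mem_univariateAlgebraic (by simp) hf)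
    exact hsup hd
  obtain ⟨e, he, hde, hde0⟩ := Subalgebra.exists_mul_mem_of_isAlgebraic hle hd hd0 halg
  obtain ⟨p, hp, hpe⟩ := mem_polynomialsIn.mp hde
  refine ⟨e, he, p, hp, ?_, hpe.symm⟩
  rintro rfl
  exact hde0 (by simpa using hpe.symm)

/-- Algebraicity is dropped here, since the rank argument works for arbitrary univariate series. -/
theorem univariateAlgebraic_sup_le_separatedSpan (k : Type*) [Field k] :
    Subalgebra.toSubmodule (univariateAlgebraic k (0 : Fin 3) ⊔ univariateAlgebraic k 1 ⊔
      univariateAlgebraic k 2) ≤ separatedSpan k := by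
  rw [← Subalgebra.mul_toSubmodule, ← Subalgebra.mul_toSubmodule, Submodule.mul_le]
  intro x hx z hz
  obtain ⟨C, -, rfl⟩ := mem_univariateAlgebraic.mp hz
  refine Submodule.mul_induction_on hx (fun x hx y hy => ?_) (fun x y hx hy => ?_)
  · obtain ⟨A, -, rfl⟩ := mem_univariateAlgebraic.mp hx
    obtain ⟨B, -, rfl⟩ := mem_univariateAlgebraic.mp hy
    exact Submodule.subset_span ⟨A, B, C, rfl⟩
  · rw [add_mul]
    exact Submodule.add_mem _ hx hy

/-! ### Algebraicity of the solutions of polynomial systems with a regular Jacobian -/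

theorem Derivation.map_mvPolynomial_aeval {k A M ι : Type*} [CommRing k] [CommRing A] [Algebra k A]
    [AddCommGroup M] [Module A M] [Module k M] [Fintype ι] (D : Derivation k A M)
    (x : ι → A) (p : MvPolynomial ι k) :
    D (MvPolynomial.aeval x p) =
      ∑ j, MvPolynomial.aeval x (MvPolynomial.pderiv j p) • D (x j) := by
  classical
  induction p using MvPolynomial.induction_on with
  | C c => simp
  | add p q hp hq => simp [hp, hq, add_smul, Finset.sum_add_distrib]
  | mul_X p i hp =>
    simp only [map_mul, MvPolynomial.aeval_X, Derivation.leibniz, hp, MvPolynomial.pderiv_X,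
      smul_eq_mul, map_add, add_smul, Finset.sum_add_distrib, Finset.smul_sum, mul_smul]
    congr 1
    rw [Finset.sum_eq_single i]
    · simp
    · intro j _ hj
      simp [Pi.single_eq_of_ne hj.symm]
    · simp

theorem Matrix.eq_zero_of_forall_sum_smul_eq_zero {E M ι : Type*} [Field E] [AddCommGroup M]
    [Module E M] [Fintype ι] [DecidableEq ι] {A : Matrix ι ι E} (hA : A.det ≠ 0) {v : ι → M}
    (hv : ∀ i, ∑ j, A i j • v j = 0) (i : ι) : v i = 0 := by
  have h : ∑ l, A.adjugate i l • ∑ j, A l j • v j = A.det • v i := by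
    simp only [Finset.smul_sum, smul_smul]
    rw [Finset.sum_comm]
    simp only [← Finset.sum_smul, ← Matrix.mul_apply, Matrix.adjugate_mul, Matrix.smul_apply,
      Matrix.one_apply, smul_eq_mul, mul_ite, mul_one, mul_zero, ite_smul, zero_smul,
      Finset.sum_ite_eq, Finset.mem_univ, if_true]
  simp only [hv, smul_zero, Finset.sum_const_zero] at h
  exact (smul_eq_zero.mp h.symm).resolve_left hA

/-- Applying the universal derivation to `P i (x) = x i` gives `(1 - J) dx = 0`, hence `dx = 0`. The
Kähler differentials of `k(x)` therefore vanish, and a finitely generated, formally unramified field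
extension is separable algebraic, in every characteristic. -/
theorem isAlgebraic_of_jacobian_ne_zero_of_field {k L : Type*} {ι : Type*} [Field k] [Field L]
    [Algebra k L] [Fintype ι] [DecidableEq ι] (x : ι → L) (P : ι → MvPolynomial ι k)
    (hx : ∀ i, MvPolynomial.aeval x (P i) = x i)
    (hdet : (1 - Matrix.of fun i j => MvPolynomial.aeval x (MvPolynomial.pderiv j (P i))).det ≠ 0)
    (i : ι) : IsAlgebraic k (x i) := by
  let E := IntermediateField.adjoin k (Set.range x)
  let y : ι → E := fun i => ⟨x i, IntermediateField.subset_adjoin k _ ⟨i, rfl⟩⟩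
  have hval : ∀ p : MvPolynomial ι k,
      E.val (MvPolynomial.aeval y p) = MvPolynomial.aeval x p := fun p => by
    rw [MvPolynomial.comp_aeval_apply]
    rfl
  have hval' : ∀ p : MvPolynomial ι k,
      ((MvPolynomial.aeval y p : E) : L) = MvPolynomial.aeval x p := hval
  have hy : ∀ i, MvPolynomial.aeval y (P i) = y i := fun i =>
    E.val.injective ((hval _).trans (hx i))
  have hdet' : (1 - Matrix.of fun i j =>
      MvPolynomial.aeval y (MvPolynomial.pderiv j (P i))).det ≠ 0 := by
    intro h
    apply hdet
    have := congrArg E.val h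
    rw [map_zero, AlgHom.map_det] at this
    rw [← this]
    congr 1
    ext i j
    by_cases hij : i = j
    · simp [hij, hval']
    · simp [hij, hval']
  have hD : ∀ i, KaehlerDifferential.D k E (y i) = 0 := by
    refine Matrix.eq_zero_of_forall_sum_smul_eq_zero hdet' fun i => ?_
    have := Derivation.map_mvPolynomial_aeval (KaehlerDifferential.D k E) y (P i)
    rw [hy] at this
    simp [sub_smul, Finset.sum_sub_distrib, ← this, Matrix.one_apply]
  have hD' : ∀ z : E, KaehlerDifferential.D k E z = 0 := by
    rintro ⟨z, hz⟩
    induction hz using IntermediateField.adjoin_induction with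
    | mem z hz =>
      obtain ⟨i, rfl⟩ := hz
      exact hD i
    | algebraMap c => exact Derivation.map_algebraMap _ c
    | add a b ha hb h1 h2 =>
      have := map_add (KaehlerDifferential.D k E) ⟨a, ha⟩ ⟨b, hb⟩
      rwa [h1, h2, add_zero] at this
    | inv a ha h =>
      have := Derivation.leibniz_inv (KaehlerDifferential.D k E) (⟨a, ha⟩ : E)
      rwa [h, smul_zero] at this
    | mul a b ha hb h1 h2 =>
      have := Derivation.leibniz (KaehlerDifferential.D k E) (⟨a, ha⟩ : E) ⟨b, hb⟩
      rwa [h1, h2, smul_zero, smul_zero, add_zero] at this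
  have hsub : Subsingleton (KaehlerDifferential k E) := by
    rw [← Submodule.subsingleton_iff E, ← subsingleton_iff_bot_eq_top,
      ← KaehlerDifferential.span_range_derivation, eq_comm, Submodule.span_eq_bot]
    rintro _ ⟨z, rfl⟩
    exact hD' z
  have hunr : Algebra.FormallyUnramified k E := ⟨hsub⟩
  have hfin : Algebra.EssFiniteType k E := by
    rw [IntermediateField.essFiniteType_iff]
    exact IntermediateField.fg_adjoin_of_finite (Set.finite_range x)
  have hsep : Algebra.IsSeparable k E := Algebra.FormallyUnramified.isSeparable k E
  have := (Algebra.IsSeparable.isSeparable k (y i)).isIntegral.isAlgebraic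
  exact this.algHom E.val

theorem isAlgebraic_of_jacobian_ne_zero {R S : Type*} {ι : Type*} [CommRing R] [IsDomain R]
    [CommRing S] [IsDomain S] [Algebra R S] [FaithfulSMul R S] [Fintype ι] [DecidableEq ι]
    (x : ι → S) (P : ι → MvPolynomial ι R) (hx : ∀ i, MvPolynomial.aeval x (P i) = x i)
    (hdet : (1 - Matrix.of fun i j => MvPolynomial.aeval x (MvPolynomial.pderiv j (P i))).det ≠ 0)
    (i : ι) : IsAlgebraic R (x i) := by
  let K := FractionRing R
  let L := FractionRing S
  let _ : Algebra K L := FractionRing.liftAlgebra R L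
  have htower : IsScalarTower R K L := inferInstance
  have hinj : Function.Injective (algebraMap S L) := IsFractionRing.injective S L
  have hval : ∀ p : MvPolynomial ι R, MvPolynomial.aeval (fun i => algebraMap S L (x i))
      (MvPolynomial.map (algebraMap R K) p) = algebraMap S L (MvPolynomial.aeval x p) := by
    intro p
    rw [MvPolynomial.aeval_map_algebraMap, ← MvPolynomial.aeval_algebraMap_apply]
    rfl
  have h := isAlgebraic_of_jacobian_ne_zero_of_field (k := K) (fun i => algebraMap S L (x i))
    (fun i => MvPolynomial.map (algebraMap R K) (P i)) (fun i => by rw [hval, hx]) ?_ i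
  · rw [← IsFractionRing.isAlgebraic_iff R K L] at h
    exact (isAlgebraic_algebraMap_iff hinj).mp h
  · have hne := hinj.ne hdet
    rw [map_zero, RingHom.map_det] at hne
    intro h0
    apply hne
    rw [← h0]
    congr 1
    ext i j
    by_cases hij : i = j
    · simp [hij, MvPolynomial.pderiv_map, hval]
    · simp [hij, MvPolynomial.pderiv_map, hval]

/-! ### Formal series of words and their evaluation on `a* b* c*` -/

/-- The Cauchy product of two series of words. -/
def wordConv {T R : Type*} [CommRing R] (f g : List T → R) (w : List T) : R :=
  ∑ i ∈ Finset.range (w.length + 1), f (w.take i) * g (w.drop i)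

theorem wordConv_nil {T R : Type*} [CommRing R] (f g : List T → R) :
    wordConv f g [] = f [] * g [] := by
  simp [wordConv]

theorem wordConv_cons {T R : Type*} [CommRing R] (f g : List T → R) (a : T) (w : List T) :
    wordConv f g (a :: w) = f [] * g (a :: w) + wordConv (fun u => f (a :: u)) g w := by
  rw [wordConv, List.length_cons, Finset.sum_range_succ', add_comm]
  simp [wordConv]

open Classical in
/-- The series of the word `w`. -/
noncomputable def wordSingle {T : Type*} (R : Type*) [CommRing R] (w v : List T) : R :=
  if v = w then 1 else 0

theorem wordSingle_nil_nil {T : Type*} (R : Type*) [CommRing R] :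
    wordSingle R ([] : List T) [] = 1 := by
  simp [wordSingle]

theorem wordSingle_nil_cons {T : Type*} (R : Type*) [CommRing R] (a : T) (v : List T) :
    wordSingle R [] (a :: v) = 0 := by
  simp [wordSingle]

theorem wordSingle_cons_nil {T : Type*} (R : Type*) [CommRing R] (a : T) (v : List T) :
    wordSingle R (a :: v) [] = 0 := by
  simp [wordSingle]

open Classical in
theorem wordSingle_cons_cons {T : Type*} (R : Type*) [CommRing R] (a b : T) (w v : List T) :
    wordSingle R (a :: w) (b :: v) = if b = a then wordSingle R w v else 0 := by
  simp [wordSingle, ite_and]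

/-- The restriction of a series of words to the powers of a letter. -/
noncomputable def unarySeries {T R : Type*} [CommRing R] (a : T) (f : List T → R) :
    PowerSeries R :=
  PowerSeries.mk fun n => f (List.replicate n a)

theorem unarySeries_wordConv {T R : Type*} [CommRing R] (a : T) (f g : List T → R) :
    unarySeries a (wordConv f g) = unarySeries a f * unarySeries a g := by
  ext n
  rw [PowerSeries.coeff_mul, Finset.Nat.sum_antidiagonal_eq_sum_range_succ_mk]
  simp only [unarySeries, PowerSeries.coeff_mk, wordConv, List.length_replicate]
  refine Finset.sum_congr rfl fun i hi => ?_
  rw [List.take_replicate, List.drop_replicate,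
    min_eq_left (Nat.lt_succ_iff.mp (Finset.mem_range.mp hi))]

theorem unarySeries_wordSingle_nil {T R : Type*} [CommRing R] (a : T) :
    unarySeries a (wordSingle R []) = 1 := by
  ext n
  cases n with
  | zero => simp [unarySeries, wordSingle]
  | succ n => simp [unarySeries, wordSingle, PowerSeries.coeff_one]

open Classical in
theorem unarySeries_wordSingle {T R : Type*} [CommRing R] (a t : T) :
    unarySeries a (wordSingle R [t]) = if a = t then PowerSeries.X else 0 := by
  ext n
  rw [unarySeries, PowerSeries.coeff_mk]
  rcases n with _ | _ | n
  · simp [wordSingle, apply_ite]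
  · split_ifs with h <;> simp [wordSingle, h]
  · split_ifs with h <;> simp [wordSingle, PowerSeries.coeff_X, List.replicate_succ]

theorem constantCoeff_unarySeries {T R : Type*} [CommRing R] (a : T) (f : List T → R) :
    PowerSeries.constantCoeff (unarySeries a f) = f [] := by
  rw [← PowerSeries.coeff_zero_eq_constantCoeff_apply, unarySeries, PowerSeries.coeff_mk]
  rfl

/-- The word `aⁱ bʲ cˡ` for the letters `a, b, c = x 0, x 1, x 2` and the exponents
`i, j, l = m 0, m 1, m 2`. -/
def sortedWord {T : Type*} (x : Fin 3 → T) (m : Fin 3 →₀ ℕ) : List T :=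
  List.replicate (m 0) (x 0) ++ List.replicate (m 1) (x 1) ++ List.replicate (m 2) (x 2)

theorem sortedWord_eq_cons {T : Type*} (x : Fin 3 → T) {m : Fin 3 →₀ ℕ} {j : Fin 3}
    (hj : m j ≠ 0) (hlt : ∀ l < j, m l = 0) :
    sortedWord x m = x j :: sortedWord x (m - Finsupp.single j 1) := by
  obtain ⟨n, hn⟩ := Nat.exists_eq_succ_of_ne_zero hj
  fin_cases j
  · simp at hn
    simp [sortedWord, hn, List.replicate_succ]
  · have := hlt 0 (by simp)
    simp at hn
    simp [sortedWord, hn, this, List.replicate_succ]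
  · have h0 := hlt 0 (by simp)
    have h1 := hlt 1 (by simp)
    simp at hn
    simp [sortedWord, hn, h0, h1, List.replicate_succ]

/-- The automaton with the states `0, 1, 2` that enters the state `j` upon reading the letter `x j`,
provided that its state was not greater, goes from `s` to `t` upon reading `sortedWord x m`. -/
def SortedPath (s t : Fin 3) (m : Fin 3 →₀ ℕ) : Prop :=
  s ≤ t ∧ (∀ j, m j ≠ 0 → s ≤ j ∧ j ≤ t) ∧ (s < t → m t ≠ 0)

theorem sortedPath_zero {s t : Fin 3} : SortedPath s t 0 ↔ s = t := by
  simp only [SortedPath, Finsupp.coe_zero, Pi.zero_apply, ne_eq, not_true_eq_false,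
    false_implies, implies_true, true_and, imp_false, not_lt]
  exact le_antisymm_iff.symm

theorem sub_single_apply_of_ne {m : Fin 3 →₀ ℕ} {j l : Fin 3} (h : l ≠ j) :
    (m - Finsupp.single j 1 : Fin 3 →₀ ℕ) l = m l := by
  simp [Finsupp.single_eq_of_ne h]

/-- One transition of the automaton: the first letter of the sorted word is the least one that
occurs. -/
theorem sortedPath_sub_single_iff {s t j : Fin 3} {m : Fin 3 →₀ ℕ} (hj : m j ≠ 0) :
    s ≤ j ∧ SortedPath j t (m - Finsupp.single j 1) ↔
      SortedPath s t m ∧ ∀ l < j, m l = 0 := by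
  constructor
  · rintro ⟨hsj, hjt, hsupp, hlast⟩
    refine ⟨⟨hsj.trans hjt, fun l hl => ?_, fun _ => ?_⟩, fun l hl => ?_⟩
    · rcases eq_or_ne l j with rfl | hlj
      · exact ⟨hsj, hjt⟩
      · have := hsupp l (by rwa [sub_single_apply_of_ne hlj])
        exact ⟨hsj.trans this.1, this.2⟩
    · rcases eq_or_ne t j with rfl | htj
      · exact hj
      · have := hlast (lt_of_le_of_ne hjt htj.symm)
        rwa [sub_single_apply_of_ne htj] at this
    · by_contra hne
      have := hsupp l (by rwa [sub_single_apply_of_ne hl.ne])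
      exact absurd this.1 (not_le.mpr hl)
  · rintro ⟨⟨hst, hsupp, hlast⟩, hmin⟩
    have hj' := hsupp j hj
    refine ⟨hj'.1, hj'.2, fun l hl => ?_, fun hjt => ?_⟩
    · have hl' : m l ≠ 0 := fun h => hl (by simp [h])
      refine ⟨?_, (hsupp l hl').2⟩
      by_contra hlt
      exact hl' (hmin l (not_le.mp hlt))
    · rw [sub_single_apply_of_ne hjt.ne']
      exact hlast (hj'.1.trans_lt hjt)

open Classical in
/-- The part of a series of words that is supported by the words `sortedWord x m` leading from the
state `s` to the state `t`. -/
noncomputable def sortedSeries {T R : Type*} [CommRing R] (x : Fin 3 → T) (f : List T → R)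
    (s t : Fin 3) : MvPowerSeries (Fin 3) R :=
  fun m => if SortedPath s t m then f (sortedWord x m) else 0

open Classical in
theorem coeff_sortedSeries {T R : Type*} [CommRing R] (x : Fin 3 → T) (f : List T → R)
    (s t : Fin 3) (m : Fin 3 →₀ ℕ) :
    MvPowerSeries.coeff m (sortedSeries x f s t) =
      if SortedPath s t m then f (sortedWord x m) else 0 := rfl

theorem sortedSeries_of_lt {T R : Type*} [CommRing R] (x : Fin 3 → T) (f : List T → R)
    {s t : Fin 3} (h : t < s) : sortedSeries x f s t = 0 := by
  ext m
  rw [coeff_sortedSeries, if_neg fun hp => absurd hp.1 (not_le.mpr h), map_zero]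

/-- States never decrease, so a path from `s` to `s` reads only the letter `x s`. -/
theorem sortedSeries_self {T R : Type*} [CommRing R] (x : Fin 3 → T) (f : List T → R)
    (s : Fin 3) : sortedSeries x f s s = (unarySeries (x s) f).toMvPowerSeries s := by
  ext m
  rw [coeff_sortedSeries, coeff_toMvPowerSeries]
  have hiff : SortedPath s s m ↔ m = Finsupp.single s (m s) := by
    simp only [SortedPath, le_refl, lt_irrefl, false_implies, and_true, true_and]
    constructor
    · intro h
      ext j
      rcases eq_or_ne j s with rfl | hj
      · simp
      · rw [Finsupp.single_eq_of_ne hj]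
        by_contra hne
        exact hj (le_antisymm (h j hne).2 (h j hne).1)
    · intro h j hj
      rw [h] at hj
      have : j = s := by
        by_contra hne
        exact hj (Finsupp.single_eq_of_ne hne)
      simp [this]
  simp only [hiff]
  split_ifs with h
  · rw [unarySeries, PowerSeries.coeff_mk]
    congr 1
    rw [h]
    fin_cases s <;> simp [sortedWord]
  · rfl

theorem coeff_X_mul_eq_ite {σ R : Type*} [CommRing R] (j : σ) (f : MvPowerSeries σ R)
    (m : σ →₀ ℕ) : MvPowerSeries.coeff m (MvPowerSeries.X j * f) =
      if m j ≠ 0 then MvPowerSeries.coeff (m - Finsupp.single j 1) f else 0 := by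
  classical
  rw [MvPowerSeries.X, MvPowerSeries.coeff_monomial_mul, one_mul]
  simp [Finsupp.single_le_iff, Nat.one_le_iff_ne_zero]

/-- Decomposition by the first letter; every recursion over sorted words below rests on it. -/
theorem sortedSeries_eq {T R : Type*} [CommRing R] (x : Fin 3 → T) (f : List T → R)
    (s t : Fin 3) :
    sortedSeries x f s t = (if s = t then MvPowerSeries.C (f []) else 0) +
      ∑ j, if s ≤ j then MvPowerSeries.X j * sortedSeries x (fun w => f (x j :: w)) j t
        else 0 := by
  classical
  ext m
  have hterm : ∀ j, MvPowerSeries.coeff m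
      (if s ≤ j then MvPowerSeries.X j * sortedSeries x (fun w => f (x j :: w)) j t else 0) =
      if m j ≠ 0 ∧ SortedPath s t m ∧ ∀ l < j, m l = 0 then f (sortedWord x m) else 0 := by
    intro j
    by_cases hj : m j = 0
    · have hneg : ¬(m j ≠ 0 ∧ SortedPath s t m ∧ ∀ l < j, m l = 0) := fun h => h.1 hj
      rw [if_neg hneg]
      split_ifs
      · rw [coeff_X_mul_eq_ite, if_neg (not_not.mpr hj)]
      · rw [map_zero]
    · have hiff := sortedPath_sub_single_iff (s := s) (t := t) hj
      by_cases h : SortedPath s t m ∧ ∀ l < j, m l = 0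
      · have hpos : m j ≠ 0 ∧ SortedPath s t m ∧ ∀ l < j, m l = 0 := ⟨hj, h⟩
        rw [if_pos hpos, if_pos (hiff.mpr h).1, coeff_X_mul_eq_ite, if_pos hj,
          coeff_sortedSeries, if_pos (hiff.mpr h).2, sortedWord_eq_cons x hj h.2]
      · have hneg : ¬(m j ≠ 0 ∧ SortedPath s t m ∧ ∀ l < j, m l = 0) := fun h' => h h'.2
        rw [if_neg hneg]
        split_ifs with hsj
        · rw [coeff_X_mul_eq_ite, if_pos hj, coeff_sortedSeries,
            if_neg fun hp => h (hiff.mp ⟨hsj, hp⟩)]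
        · rw [map_zero]
  rw [map_add, map_sum, Finset.sum_congr rfl fun j _ => hterm j, coeff_sortedSeries]
  by_cases hm : m = 0
  · subst hm
    simp only [sortedPath_zero, Finsupp.coe_zero, Pi.zero_apply, ne_eq, not_true_eq_false,
      false_and, if_false, Finset.sum_const_zero, add_zero]
    split_ifs <;> simp [sortedWord]
  · have h0 : MvPowerSeries.coeff m
        (if s = t then MvPowerSeries.C (f []) else 0 : MvPowerSeries (Fin 3) R) = 0 := by
      split_ifs
      · rw [MvPowerSeries.coeff_C, if_neg hm]
      · rw [map_zero]
    rw [h0, zero_add]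
    have hne : m.support.Nonempty := Finsupp.support_nonempty_iff.mpr hm
    have hmin : m (m.support.min' hne) ≠ 0 := Finsupp.mem_support_iff.mp (m.support.min'_mem hne)
    have hlt : ∀ l < m.support.min' hne, m l = 0 := fun l hl => by
      by_contra h
      exact absurd (m.support.min'_le l (Finsupp.mem_support_iff.mpr h)) (not_le.mpr hl)
    rw [Finset.sum_eq_single (m.support.min' hne)]
    · by_cases hp : SortedPath s t m
      · rw [if_pos hp, if_pos ⟨hmin, hp, hlt⟩]
      · rw [if_neg hp, if_neg fun h => hp h.2.1]
    · intro j _ hj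
      refine if_neg fun h => ?_
      rcases lt_or_gt_of_ne hj with hj | hj
      · exact h.1 (hlt j hj)
      · exact hmin (h.2.2 _ hj)
    · simp

/-- The automaton is deterministic, so each cut of a sorted word passes through exactly one
intermediate state `u`. The proof shows that the difference of the two sides satisfies a homogeneous
first-letter recursion (`hrec`). -/
theorem sortedSeries_wordConv {T R : Type*} [CommRing R] (x : Fin 3 → T) (f g : List T → R)
    (s t : Fin 3) : sortedSeries x (wordConv f g) s t =
      ∑ u, sortedSeries x f s u * sortedSeries x g u t := by
  have hrec : ∀ (f : List T → R) (s : Fin 3), sortedSeries x (wordConv f g) s t -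
      ∑ u, sortedSeries x f s u * sortedSeries x g u t =
      ∑ j, if s ≤ j then MvPowerSeries.X j *
        (sortedSeries x (wordConv (fun w => f (x j :: w)) g) j t -
          ∑ u, sortedSeries x (fun w => f (x j :: w)) j u * sortedSeries x g u t) else 0 := by
    intro f s
    have h1 : ∀ j, sortedSeries x (fun w => wordConv f g (x j :: w)) j t =
        MvPowerSeries.C (f []) * sortedSeries x (fun w => g (x j :: w)) j t +
          sortedSeries x (wordConv (fun w => f (x j :: w)) g) j t := by
      intro j
      ext m
      rw [map_add, MvPowerSeries.coeff_C_mul, coeff_sortedSeries, coeff_sortedSeries,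
        coeff_sortedSeries, wordConv_cons]
      split_ifs <;> simp
    have h2 : ∑ u, sortedSeries x f s u * sortedSeries x g u t =
        MvPowerSeries.C (f []) * sortedSeries x g s t + ∑ j, if s ≤ j then MvPowerSeries.X j *
          ∑ u, sortedSeries x (fun w => f (x j :: w)) j u * sortedSeries x g u t else 0 := by
      have : ∀ u, sortedSeries x f s u * sortedSeries x g u t =
          (if s = u then MvPowerSeries.C (f []) * sortedSeries x g u t else 0) +
          ∑ j, if s ≤ j then MvPowerSeries.X j *
            (sortedSeries x (fun w => f (x j :: w)) j u * sortedSeries x g u t) else 0 := by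
        intro u
        conv_lhs => rw [sortedSeries_eq x f s u]
        rw [add_mul, Finset.sum_mul]
        congr 1
        · split_ifs <;> simp
        · refine Finset.sum_congr rfl fun j _ => ?_
          split_ifs
          · ring
          · ring
      rw [Finset.sum_congr rfl fun u _ => this u, Finset.sum_add_distrib, Finset.sum_comm]
      congr 1
      · simp
      · refine Finset.sum_congr rfl fun j _ => ?_
        split_ifs
        · rw [Finset.mul_sum]
        · simp
    rw [h2, sortedSeries_eq x (wordConv f g) s t, wordConv_nil]
    conv_lhs => rw [sortedSeries_eq x g s t]
    simp only [h1]
    have h3 : (if s = t then MvPowerSeries.C (f [] * g []) else 0) = MvPowerSeries.C (f []) *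
        (if s = t then MvPowerSeries.C (g []) else 0 : MvPowerSeries (Fin 3) R) := by
      split_ifs <;> simp
    rw [mul_add, Finset.mul_sum, add_sub_add_comm, h3, sub_add_cancel_left,
      ← Finset.sum_neg_distrib, ← Finset.sum_sub_distrib, ← Finset.sum_add_distrib]
    refine Finset.sum_congr rfl fun j _ => ?_
    split_ifs
    · ring
    · ring
  rw [← sub_eq_zero]
  -- The induction on `m` has to quantify over `f` and `s`, because reading a letter changes both.
  have key : ∀ (m : Fin 3 →₀ ℕ) (f : List T → R) (s : Fin 3),
      MvPowerSeries.coeff m (sortedSeries x (wordConv f g) s t -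
        ∑ u, sortedSeries x f s u * sortedSeries x g u t) = 0 := by
    intro m
    induction m using WellFoundedLT.induction with
    | ind m ih =>
      intro f s
      rw [hrec, map_sum]
      refine Finset.sum_eq_zero fun j _ => ?_
      split_ifs with hsj
      · rw [coeff_X_mul_eq_ite]
        split_ifs with hj
        · refine ih _ ?_ _ _
          refine lt_of_le_of_ne tsub_le_self fun h => hj ?_
          have := DFunLike.congr_fun h j
          simp at this
          omega
        · rfl
      · rw [map_zero]
  ext m
  rw [key, map_zero]

theorem sortedSeries_wordSingle_nil {T R : Type*} [CommRing R] (x : Fin 3 → T) (s t : Fin 3) :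
    sortedSeries x (wordSingle R []) s t = if s = t then 1 else 0 := by
  have h0 : ∀ j, sortedSeries x (fun w => wordSingle R [] (x j :: w)) j t = 0 := by
    intro j
    ext m
    rw [coeff_sortedSeries]
    simp [wordSingle_nil_cons]
  rw [sortedSeries_eq, wordSingle_nil_nil]
  simp [h0]

open Classical in
theorem sortedSeries_wordSingle {T R : Type*} [CommRing R] (x : Fin 3 → T) (a : T)
    (s t : Fin 3) : sortedSeries x (wordSingle R [a]) s t =
      if s ≤ t ∧ x t = a then MvPowerSeries.X t else 0 := by
  have h0 : ∀ j, sortedSeries x (fun w => wordSingle R [a] (x j :: w)) j t =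
      if x j = a ∧ j = t then 1 else 0 := by
    intro j
    by_cases hj : x j = a
    · have : (fun w => wordSingle R [a] (x j :: w)) = wordSingle R ([] : List T) := by
        funext w
        rw [wordSingle_cons_cons, if_pos hj]
      rw [this, sortedSeries_wordSingle_nil]
      simp only [hj, true_and]
    · ext m
      rw [coeff_sortedSeries]
      simp [wordSingle_cons_cons, hj]
  rw [sortedSeries_eq, wordSingle_cons_nil, Finset.sum_eq_single t]
  · simp only [h0, and_true]
    by_cases h1 : s ≤ t <;> by_cases h2 : x t = a <;> simp [h1, h2]
  · intro j _ hj
    simp [h0, hj]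
  · simp

/-! ### Systems of equations for series of words -/

/-- The series of a symbol, for given series of the nonterminals. -/
noncomputable def symbolSeries {T N R : Type*} [CommRing R] (F : N → List T → R) :
    Symbol T N → List T → R
  | .terminal t => wordSingle R [t]
  | .nonterminal A => F A

/-- The series of a sentential form, for given series of the nonterminals. -/
noncomputable def formSeries {T N R : Type*} [CommRing R] (F : N → List T → R) :
    List (Symbol T N) → List T → R
  | [] => wordSingle R []
  | X :: α => wordConv (symbolSeries F X) (formSeries F α)

theorem formSeries_nil {T N R : Type*} [CommRing R] (F : N → List T → R)
    (α : List (Symbol T N)) :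
    formSeries F α [] = (α.map fun X => symbolSeries F X []).prod := by
  induction α with
  | nil => exact wordSingle_nil_nil R
  | cons X α ih => rw [formSeries, wordConv_nil, ih, List.map_cons, List.prod_cons]

theorem unarySeries_formSeries {T N R : Type*} [CommRing R] (F : N → List T → R) (a : T)
    (α : List (Symbol T N)) :
    unarySeries a (formSeries F α) = (α.map fun X => unarySeries a (symbolSeries F X)).prod := by
  induction α with
  | nil => exact unarySeries_wordSingle_nil a
  | cons X α ih => rw [formSeries, unarySeries_wordConv, ih, List.map_cons, List.prod_cons]

theorem sortedSeries_formSeries_self {T N R : Type*} [CommRing R] (F : N → List T → R)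
    (x : Fin 3 → T) (s : Fin 3) (α : List (Symbol T N)) :
    sortedSeries x (formSeries F α) s s =
      (α.map fun X => sortedSeries x (symbolSeries F X) s s).prod := by
  rw [sortedSeries_self, unarySeries_formSeries, map_list_prod, List.map_map]
  congr 2
  funext X
  exact (sortedSeries_self x _ s).symm

/-- A finite system of equations for series of words such that the dependence of the constant
terms of these series on one another is acyclic. -/
structure RegularSystem (T N R : Type*) [CommRing R] where
  /-- The right-hand sides of the rules for a nonterminal. -/
  rules : N → Finset (List (Symbol T N))
  /-- The series of a nonterminal. -/
  series : N → List T → R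
  series_eq : ∀ A w, series A w = ∑ β ∈ rules A, formSeries series β w
  /-- A rank that decreases along the dependence of the constant terms. -/
  rank : N → ℕ
  rank_lt : ∀ A (α γ : List (Symbol T N)) (B : N), α ++ .nonterminal B :: γ ∈ rules A →
    formSeries series α [] ≠ 0 → formSeries series γ [] ≠ 0 → rank B < rank A

open Classical in
/-- The sum, over all occurrences of the nonterminal `B` in a sentential form, of the product of the
values of `φ` to the left of the occurrence and of the values of `ψ` to the right of it. -/
noncomputable def occurrenceSum {T N K : Type*} [CommRing K] (φ ψ : Symbol T N → K) (B : N) :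
    List (Symbol T N) → K
  | [] => 0
  | X :: α => (if X = .nonterminal B then (α.map ψ).prod else 0) + φ X * occurrenceSum φ ψ B α

theorem occurrenceSum_mem {T N K σ : Type*} [CommRing K] [SetLike σ K] [SubringClass σ K] (S : σ)
    {φ ψ : Symbol T N → K} (hφ : ∀ X, φ X ∈ S) (hψ : ∀ X, ψ X ∈ S) (B : N)
    (α : List (Symbol T N)) : occurrenceSum φ ψ B α ∈ S := by
  induction α with
  | nil => exact zero_mem S
  | cons X α ih =>
    rw [occurrenceSum]
    refine add_mem ?_ (mul_mem (hφ X) ih)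
    split_ifs
    · refine list_prod_mem fun y hy => ?_
      obtain ⟨Y, -, rfl⟩ := List.mem_map.mp hy
      exact hψ Y
    · exact zero_mem S

theorem exists_split_of_map_occurrenceSum_ne_zero {T N K R : Type*} [CommRing K] [CommRing R]
    [NoZeroDivisors R] (χ : K →+* R) {φ ψ : Symbol T N → K} {ε : Symbol T N → R} (hφ : ∀ X, χ (φ X) = ε X)
    (hψ : ∀ X, χ (ψ X) = ε X) {B : N} {α : List (Symbol T N)}
    (h : χ (occurrenceSum φ ψ B α) ≠ 0) :
    ∃ β γ, α = β ++ .nonterminal B :: γ ∧ (β.map ε).prod ≠ 0 ∧ (γ.map ε).prod ≠ 0 := by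
  induction α with
  | nil => exact absurd (map_zero χ) h
  | cons X α ih =>
    rw [occurrenceSum, map_add, map_mul] at h
    have hR : Nontrivial R := nontrivial_of_ne _ _ h
    by_cases h1 : χ (if X = .nonterminal B then (α.map ψ).prod else 0) = 0
    · rw [h1, zero_add] at h
      obtain ⟨β, γ, rfl, hβ, hγ⟩ := ih (right_ne_zero_of_mul h)
      refine ⟨X :: β, γ, rfl, ?_, hγ⟩
      rw [List.map_cons, List.prod_cons, ← hφ]
      exact mul_ne_zero (left_ne_zero_of_mul h) hβ
    · split_ifs at h1 with hX
      · refine ⟨[], α, by rw [hX]; rfl, by simp, ?_⟩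
        rw [map_list_prod, List.map_map] at h1
        have hcomp : χ ∘ ψ = ε := funext hψ
        rwa [hcomp] at h1
      · exact absurd (map_zero χ) h1

/-- Modulo `M` the function `v` obeys a twisted Leibniz rule, so it is linear in the values `μ` of
the nonterminals. It is used with `φ`, `ψ`, `μ` the matrix entries `(s, s)`, `(t, t)`, `(s, t)`. -/
theorem sub_sum_occurrenceSum_mem {T N K : Type*} [CommRing K] [Fintype N] (M : AddSubgroup K)
    {φ ψ μ : Symbol T N → K} {v : List (Symbol T N) → K} (h0 : v [] ∈ M)
    (hM : ∀ X, ∀ y ∈ M, φ X * y ∈ M)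
    (hterm : ∀ t (α : List (Symbol T N)), μ (.terminal t) * (α.map ψ).prod ∈ M)
    (hrec : ∀ X α, v (X :: α) - (φ X * v α + μ X * (α.map ψ).prod) ∈ M)
    (α : List (Symbol T N)) :
    v α - ∑ B, occurrenceSum φ ψ B α * μ (.nonterminal B) ∈ M := by
  classical
  induction α with
  | nil => simpa [occurrenceSum] using h0
  | cons X α ih =>
    have h1 := M.add_mem (hrec X α) (hM X _ ih)
    have h2 : ∑ B, occurrenceSum φ ψ B (X :: α) * μ (.nonterminal B) =
        (∑ B, if X = .nonterminal B then (α.map ψ).prod * μ (.nonterminal B) else 0) +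
          φ X * ∑ B, occurrenceSum φ ψ B α * μ (.nonterminal B) := by
      rw [Finset.mul_sum, ← Finset.sum_add_distrib]
      refine Finset.sum_congr rfl fun B _ => ?_
      rw [occurrenceSum]
      split_ifs <;> ring
    rw [h2]
    cases X with
    | terminal t =>
      have h3 := M.add_mem h1 (hterm t α)
      simp only [reduceCtorEq, if_false, Finset.sum_const_zero, zero_add]
      convert h3 using 1
      ring
    | nonterminal A =>
      simp only [Symbol.nonterminal.injEq, Finset.sum_ite_eq, Finset.mem_univ, if_true]
      convert h1 using 1
      ring

/-! ### Determinants and Cramer's rule. -/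

theorem Matrix.det_one_sub_ne_zero_of_rank {K R N : Type*} [CommRing K] [Field R] [Fintype N]
    [DecidableEq N] (χ : K →+* R) (J : Matrix N N K) (rank : N → ℕ)
    (h : ∀ A B, χ (J A B) ≠ 0 → rank B < rank A) : (1 - J).det ≠ 0 := by
  intro hdet
  have h1 := congrArg χ hdet
  rw [RingHom.map_det, map_zero, ← Matrix.exists_mulVec_eq_zero_iff] at h1
  obtain ⟨v, hv, hmul⟩ := h1
  apply hv
  -- The vector satisfies `v = χ(J) v`, where `χ(J)` is strictly triangular with respect to `rank`.
  have key : ∀ n A, rank A = n → v A = 0 := by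
    intro n
    induction n using Nat.strong_induction_on with
    | _ n ih =>
      intro A hA
      have h2 := congrFun hmul A
      rw [map_sub, map_one, Matrix.sub_mulVec, Matrix.one_mulVec, Pi.sub_apply, Pi.zero_apply,
        sub_eq_zero] at h2
      rw [h2]
      refine Finset.sum_eq_zero fun B _ => ?_
      by_cases hB : χ (J A B) = 0
      · simp [hB]
      · rw [ih _ (hA ▸ h A B hB) B rfl, mul_zero]
  funext A
  exact key _ A rfl

theorem Subalgebra.det_mem {k K N : Type*} [CommRing k] [CommRing K] [Algebra k K] [Fintype N]
    [DecidableEq N] (S : Subalgebra k K) {A : Matrix N N K} (hA : ∀ i j, A i j ∈ S) :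
    A.det ∈ S := by
  have : A = S.val.mapMatrix (Matrix.of fun i j => (⟨A i j, hA i j⟩ : S)) := rfl
  rw [this, ← AlgHom.map_det]
  exact Subtype.property _

theorem Subalgebra.adjugate_mem {k K N : Type*} [CommRing k] [CommRing K] [Algebra k K] [Fintype N]
    [DecidableEq N] (S : Subalgebra k K) {A : Matrix N N K} (hA : ∀ i j, A i j ∈ S) (i j : N) :
    A.adjugate i j ∈ S := by
  have : A = S.val.mapMatrix (Matrix.of fun i j => (⟨A i j, hA i j⟩ : S)) := rfl
  rw [this, ← AlgHom.map_adjugate]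
  exact Subtype.property _

/-- Cramer's rule modulo `M`: multiply `(1 - J) v` by the adjugate of `1 - J`. -/
theorem Subalgebra.det_one_sub_mul_mem {k K N : Type*} [CommRing k] [CommRing K] [Algebra k K]
    [Fintype N] [DecidableEq N] (S : Subalgebra k K) (M : AddSubgroup K)
    (hM : ∀ s ∈ S, ∀ y ∈ M, s * y ∈ M) {J : Matrix N N K} (hJ : ∀ i j, J i j ∈ S) {v : N → K}
    (hv : ∀ i, v i - ∑ j, J i j * v j ∈ M) (i : N) : (1 - J).det * v i ∈ M := by
  have h1 : ∀ i j, (1 - J) i j ∈ S := fun i j => by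
    rw [Matrix.sub_apply, Matrix.one_apply]
    refine S.sub_mem ?_ (hJ i j)
    split_ifs
    exacts [S.one_mem, S.zero_mem]
  have h2 : (1 - J).det * v i = ∑ j, (1 - J).adjugate i j * (v j - ∑ l, J j l * v l) := by
    have h3 := congrFun (congrArg (Matrix.mulVec · v) (Matrix.adjugate_mul (1 - J))) i
    simp only [← Matrix.mulVec_mulVec, Matrix.smul_mulVec, Matrix.one_mulVec, Pi.smul_apply,
      smul_eq_mul, Matrix.sub_mulVec] at h3
    exact h3.symm
  rw [h2]
  exact M.sum_mem fun j _ => hM _ (S.adjugate_mem h1 i j) _ (hv j)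

/-! ### Algebraicity and denominators for the solution of a regular system. -/

namespace RegularSystem

variable {T N k : Type*} [Field k] (P : RegularSystem T N k)

theorem rank_lt_of_occurrenceSum {K : Type*} [CommRing K] (χ : K →+* k) {φ ψ : Symbol T N → K}
    (hφ : ∀ X, χ (φ X) = symbolSeries P.series X [])
    (hψ : ∀ X, χ (ψ X) = symbolSeries P.series X []) (A B : N)
    (h : χ (∑ β ∈ P.rules A, occurrenceSum φ ψ B β) ≠ 0) : P.rank B < P.rank A := by
  rw [map_sum] at h
  obtain ⟨β, hβ, hne⟩ := Finset.exists_ne_zero_of_sum_ne_zero h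
  obtain ⟨α, γ, rfl, hα, hγ⟩ := exists_split_of_map_occurrenceSum_ne_zero χ hφ hψ hne
  refine P.rank_lt A α γ B hβ ?_ ?_
  · rwa [formSeries_nil]
  · rwa [formSeries_nil]

theorem sortedSeries_formSeries_cons (x : Fin 3 → T) (X : Symbol T N) (α : List (Symbol T N))
    (s t : Fin 3) : sortedSeries x (formSeries P.series (X :: α)) s t =
      sortedSeries x (symbolSeries P.series X) s 0 * sortedSeries x (formSeries P.series α) 0 t +
      sortedSeries x (symbolSeries P.series X) s 1 * sortedSeries x (formSeries P.series α) 1 t +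
      sortedSeries x (symbolSeries P.series X) s 2 *
        sortedSeries x (formSeries P.series α) 2 t := by
  rw [formSeries, sortedSeries_wordConv, Fin.sum_univ_three]

variable [Fintype N]

/-- On powers of one letter the system becomes a commutative polynomial system. Its Jacobian
consists of occurrence sums, whose constant terms are strictly triangular by rank. -/
theorem isAlgebraic_unarySeries_series (a : T) (A : N) :
    IsAlgebraic (Polynomial k) (unarySeries a (P.series A)) := by
  classical
  let φ : Symbol T N → PowerSeries k := fun X => unarySeries a (symbolSeries P.series X)
  let y : Symbol T N → MvPolynomial N (Polynomial k)
    | .terminal t => MvPolynomial.C (if a = t then Polynomial.X else 0)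
    | .nonterminal B => MvPolynomial.X B
  let x : N → PowerSeries k := fun A => unarySeries a (P.series A)
  have hy : ∀ X, MvPolynomial.aeval x (y X) = φ X := by
    rintro (t | B)
    · simp only [y, φ, symbolSeries, unarySeries_wordSingle]
      rw [MvPolynomial.aeval_C, algebraMap_polynomial_powerSeries]
      split_ifs <;> simp
    · simp [y, φ, x, symbolSeries]
  have hy' : ∀ α : List (Symbol T N), MvPolynomial.aeval x (α.map y).prod = (α.map φ).prod := by
    intro α
    rw [map_list_prod, List.map_map]
    congr 2
    funext X
    exact hy X
  have hsum : ∀ A, unarySeries a (P.series A) = ∑ β ∈ P.rules A, (β.map φ).prod := by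
    intro A
    simp only [φ, ← unarySeries_formSeries]
    ext n
    simp [unarySeries, P.series_eq A]
  have hder : ∀ B (α : List (Symbol T N)),
      MvPolynomial.aeval x (MvPolynomial.pderiv B (α.map y).prod) = occurrenceSum φ φ B α := by
    intro B α
    induction α with
    | nil => simp [occurrenceSum]
    | cons X α ih =>
      rw [List.map_cons, List.prod_cons, Derivation.leibniz, map_add, smul_eq_mul, smul_eq_mul,
        map_mul, map_mul, ih, hy, hy', occurrenceSum, add_comm]
      congr 1
      rcases X with t | C
      · simp [y]
      · by_cases hC : C = B
        · simp [y, hC]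
        · simp [y, hC, MvPolynomial.pderiv_X]
  have : FaithfulSMul (Polynomial k) (PowerSeries k) := by
    rw [faithfulSMul_iff_algebraMap_injective]
    intro p q h
    simpa [algebraMap_polynomial_powerSeries] using h
  refine isAlgebraic_of_jacobian_ne_zero x (fun A => ∑ β ∈ P.rules A, (β.map y).prod) ?_ ?_ A
  · intro A
    rw [map_sum]
    refine Eq.trans ?_ (hsum A).symm
    exact Finset.sum_congr rfl fun β _ => hy' β
  · refine Matrix.det_one_sub_ne_zero_of_rank PowerSeries.constantCoeff _ P.rank fun A B h => ?_
    simp only [Matrix.of_apply, map_sum, hder] at h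
    refine P.rank_lt_of_occurrenceSum PowerSeries.constantCoeff (φ := φ) (ψ := φ) ?_ ?_ A B
      (by rwa [map_sum])
    · exact fun X => constantCoeff_unarySeries a _
    · exact fun X => constantCoeff_unarySeries a _

theorem sortedSeries_self_mem (x : Fin 3 → T) (s : Fin 3) (X : Symbol T N) :
    sortedSeries x (symbolSeries P.series X) s s ∈ univariateAlgebraic k s := by
  classical
  rcases X with t | A
  · rw [symbolSeries, sortedSeries_wordSingle]
    split_ifs
    · exact X_mem_univariateAlgebraic k s
    · exact Subalgebra.zero_mem _
  · rw [sortedSeries_self]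
    exact mem_univariateAlgebraic.mpr ⟨_, P.isAlgebraic_unarySeries_series (x s) A, rfl⟩

theorem sortedSeries_formSeries_self_mem (x : Fin 3 → T) (s : Fin 3) (α : List (Symbol T N)) :
    sortedSeries x (formSeries P.series α) s s ∈ univariateAlgebraic k s := by
  rw [sortedSeries_formSeries_self]
  refine Subalgebra.list_prod_mem _ fun y hy => ?_
  obtain ⟨X, -, rfl⟩ := List.mem_map.mp hy
  exact P.sortedSeries_self_mem x s X

theorem constantCoeff_sortedSeries_self (x : Fin 3 → T) (s : Fin 3) (f : List T → k) :
    MvPowerSeries.constantCoeff (sortedSeries x f s s) = f [] := by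
  classical
  rw [← MvPowerSeries.coeff_zero_eq_constantCoeff_apply, coeff_sortedSeries,
    if_pos (sortedPath_zero.mpr rfl)]
  simp [sortedWord]

/-- The subgroup `M` holds whatever counts as already known. For adjacent states it is the algebra
of the two variables itself; for `(0, 2)` it must also absorb the products of entries through state
`1`. -/
theorem exists_mul_sortedSeries_mem (x : Fin 3 → T) {s t : Fin 3} (hst : s < t)
    (M : AddSubgroup (MvPowerSeries (Fin 3) k))
    (hSM : ∀ y ∈ univariateAlgebraic k s ⊔ univariateAlgebraic k t, y ∈ M)
    (hmul : ∀ e ∈ univariateAlgebraic k s ⊔ univariateAlgebraic k t, ∀ y ∈ M, e * y ∈ M)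
    (hrec : ∀ X (α : List (Symbol T N)), sortedSeries x (formSeries P.series (X :: α)) s t -
      (sortedSeries x (symbolSeries P.series X) s s * sortedSeries x (formSeries P.series α) s t +
        sortedSeries x (symbolSeries P.series X) s t *
          sortedSeries x (formSeries P.series α) t t) ∈ M) :
    ∃ p ∈ MvPolynomial.supported k {s, t}, p ≠ 0 ∧ ∀ X,
      (p : MvPowerSeries (Fin 3) k) * sortedSeries x (symbolSeries P.series X) s t ∈ M := by
  classical
  set S := univariateAlgebraic k s ⊔ univariateAlgebraic k t
  have hsS : univariateAlgebraic k s ≤ S := le_sup_left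
  have htS : univariateAlgebraic k t ≤ S := le_sup_right
  let φ : Symbol T N → MvPowerSeries (Fin 3) k :=
    fun X => sortedSeries x (symbolSeries P.series X) s s
  let ψ : Symbol T N → MvPowerSeries (Fin 3) k :=
    fun X => sortedSeries x (symbolSeries P.series X) t t
  let μ : Symbol T N → MvPowerSeries (Fin 3) k :=
    fun X => sortedSeries x (symbolSeries P.series X) s t
  have hψ : ∀ α : List (Symbol T N),
      (α.map ψ).prod = sortedSeries x (formSeries P.series α) t t := fun α =>
    (sortedSeries_formSeries_self P.series x t α).symm
  let J : Matrix N N (MvPowerSeries (Fin 3) k) :=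
    Matrix.of fun A B => ∑ β ∈ P.rules A, occurrenceSum φ ψ B β
  have hJ : ∀ A B, J A B ∈ S := fun A B => S.sum_mem fun β _ =>
    occurrenceSum_mem S (fun X => hsS (P.sortedSeries_self_mem x s X))
      (fun X => htS (P.sortedSeries_self_mem x t X)) B β
  have hterm : ∀ a, μ (.terminal a) ∈ S := by
    intro a
    simp only [μ, symbolSeries, sortedSeries_wordSingle]
    split_ifs
    · exact htS (X_mem_univariateAlgebraic k t)
    · exact S.zero_mem
  have hdet : (1 - J).det ≠ 0 :=
    Matrix.det_one_sub_ne_zero_of_rank MvPowerSeries.constantCoeff J P.rank fun A B h =>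
      P.rank_lt_of_occurrenceSum MvPowerSeries.constantCoeff
        (fun X => constantCoeff_sortedSeries_self x s _)
        (fun X => constantCoeff_sortedSeries_self x t _) A B h
  have hdetS : (1 - J).det ∈ S := S.det_mem fun A B => by
    rw [Matrix.sub_apply, Matrix.one_apply]
    refine S.sub_mem ?_ (hJ A B)
    split_ifs
    exacts [S.one_mem, S.zero_mem]
  -- The denominator is a polynomial multiple of the determinant, common to all nonterminals.
  obtain ⟨e, he, p, hp, hp0, hdp⟩ := exists_mul_eq_polynomial hdetS hdet
  refine ⟨p, hp, hp0, ?_⟩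
  have hform : ∀ α, sortedSeries x (formSeries P.series α) s t -
      ∑ B, occurrenceSum φ ψ B α * μ (.nonterminal B) ∈ M := by
    refine sub_sum_occurrenceSum_mem M ?_ ?_ ?_ ?_
    · rw [formSeries, sortedSeries_wordSingle_nil, if_neg hst.ne]
      exact M.zero_mem
    · exact fun X y hy => hmul _ (hsS (P.sortedSeries_self_mem x s X)) y hy
    · intro a α
      rw [hψ]
      exact hSM _ (S.mul_mem (hterm a) (htS (P.sortedSeries_formSeries_self_mem x t α)))
    · intro X α
      rw [hψ]
      exact hrec X α
  have hv : ∀ A, μ (.nonterminal A) - ∑ B, J A B * μ (.nonterminal B) ∈ M := by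
    intro A
    have hA : μ (.nonterminal A) = ∑ β ∈ P.rules A, sortedSeries x (formSeries P.series β) s t := by
      ext m
      rw [map_sum]
      simp only [μ, symbolSeries, coeff_sortedSeries]
      split_ifs
      · exact P.series_eq A _
      · simp
    have hB : ∑ B, J A B * μ (.nonterminal B) =
        ∑ β ∈ P.rules A, ∑ B, occurrenceSum φ ψ B β * μ (.nonterminal B) := by
      rw [Finset.sum_comm]
      refine Finset.sum_congr rfl fun B _ => ?_
      exact Finset.sum_mul _ _ _
    rw [hA, hB, ← Finset.sum_sub_distrib]
    exact M.sum_mem fun β _ => hform β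
  rintro (a | A)
  · refine hSM _ (S.mul_mem ?_ (hterm a))
    rw [← hdp]
    exact S.mul_mem hdetS he
  · rw [← hdp, mul_comm _ e, mul_assoc]
    exact hmul e he _ (S.det_one_sub_mul_mem M hmul hJ hv A)

theorem exists_mul_sortedSeries_zero_two_mem (x : Fin 3 → T) :
    ∃ p ∈ MvPolynomial.supported k {0, 1}, ∃ q ∈ MvPolynomial.supported k {0, 2},
      ∃ r ∈ MvPolynomial.supported k {1, 2}, p ≠ 0 ∧ q ≠ 0 ∧ r ≠ 0 ∧ ∀ A,
      ((p * q * r : MvPolynomial (Fin 3) k) : MvPowerSeries (Fin 3) k) *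
        sortedSeries x (P.series A) 0 2 ∈
        univariateAlgebraic k 0 ⊔ univariateAlgebraic k 1 ⊔ univariateAlgebraic k 2 := by
  obtain ⟨p, hp, hp0, hpX⟩ := P.exists_mul_sortedSeries_mem x (s := 0) (t := 1) (by decide)
    (univariateAlgebraic k 0 ⊔ univariateAlgebraic k 1).toSubring.toAddSubgroup
    (fun y hy => hy) (fun e he y hy => Subalgebra.mul_mem _ he hy) fun X α => by
      rw [P.sortedSeries_formSeries_cons, sortedSeries_of_lt x _ (show (1 : Fin 3) < 2 by decide),
        mul_zero, add_zero, sub_self]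
      exact zero_mem _
  obtain ⟨r, hr, hr0, hrX⟩ := P.exists_mul_sortedSeries_mem x (s := 1) (t := 2) (by decide)
    (univariateAlgebraic k 1 ⊔ univariateAlgebraic k 2).toSubring.toAddSubgroup
    (fun y hy => hy) (fun e he y hy => Subalgebra.mul_mem _ he hy) fun X α => by
      rw [P.sortedSeries_formSeries_cons, sortedSeries_of_lt x _ (show (0 : Fin 3) < 1 by decide),
        zero_mul, zero_add, sub_self]
      exact zero_mem _
  set S : Subalgebra k (MvPowerSeries (Fin 3) k) :=
    univariateAlgebraic k 0 ⊔ univariateAlgebraic k 1 ⊔ univariateAlgebraic k 2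
  have h0 : univariateAlgebraic k 0 ≤ S := le_sup_left.trans le_sup_left
  have h1 : univariateAlgebraic k 1 ≤ S := le_sup_right.trans le_sup_left
  have h2 : univariateAlgebraic k 2 ≤ S := le_sup_right
  have hrα : ∀ α, (r : MvPowerSeries (Fin 3) k) *
      sortedSeries x (formSeries P.series α) 1 2 ∈ S := by
    intro α
    induction α with
    | nil =>
      rw [formSeries, sortedSeries_wordSingle_nil, if_neg (by decide), mul_zero]
      exact S.zero_mem
    | cons X α ih =>
      rw [P.sortedSeries_formSeries_cons, sortedSeries_of_lt x _ (show (0 : Fin 3) < 1 by decide),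
        zero_mul, zero_add, mul_add, mul_left_comm, ← mul_assoc (r : MvPowerSeries (Fin 3) k)]
      exact S.add_mem (S.mul_mem (h1 (P.sortedSeries_self_mem x 1 X)) ih)
        (S.mul_mem (sup_le h1 h2 (hrX X)) (h2 (P.sortedSeries_formSeries_self_mem x 2 α)))
  have hpS : (p : MvPowerSeries (Fin 3) k) ∈ S :=
    polynomialsIn_le (by rintro i (rfl | rfl); exacts [h0, h1]) (mem_polynomialsIn.mpr ⟨p, hp, rfl⟩)
  have hrS : (r : MvPowerSeries (Fin 3) k) ∈ S :=
    polynomialsIn_le (by rintro i (rfl | rfl); exacts [h1, h2]) (mem_polynomialsIn.mpr ⟨r, hr, rfl⟩)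
  have h02 : univariateAlgebraic k 0 ⊔ univariateAlgebraic k 2 ≤ S := sup_le h0 h2
  -- Here `M` is the set of `y` with `p r y ∈ S`: in the product of an entry `(0, 1)` and an entry
  -- `(1, 2)`, `p` clears the first factor and `r` the second.
  obtain ⟨q, hq, hq0, hqX⟩ := P.exists_mul_sortedSeries_mem x (s := 0) (t := 2) (by decide)
    (S.toSubring.toAddSubgroup.comap
      (AddMonoidHom.mulLeft ((p : MvPowerSeries (Fin 3) k) * r)))
    (fun y hy => S.mul_mem (S.mul_mem hpS hrS) (h02 hy))
    (fun e he y hy => by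
      have := S.mul_mem (h02 he) hy
      change _ * _ ∈ S
      convert this using 1
      simp only [AddMonoidHom.coe_mulLeft]
      ring)
    (fun X α => by
      have := S.mul_mem (sup_le h0 h1 (hpX X)) (hrα α)
      change _ * _ ∈ S
      convert this using 1
      rw [P.sortedSeries_formSeries_cons]
      ring)
  refine ⟨p, hp, q, hq, r, hr, hp0, hq0, hr0, fun A => ?_⟩
  have h : _ * _ ∈ S := hqX (.nonterminal A)
  rw [symbolSeries] at h
  convert h using 1
  rw [MvPolynomial.coe_mul, MvPolynomial.coe_mul]
  ring

end RegularSystem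

/-! ### Counting parse trees -/

theorem wordConv_wordSingle_nil {T R : Type*} [CommRing R] (f : List T → R) :
    wordConv (wordSingle R []) f = f := by
  funext w
  cases w with
  | nil => rw [wordConv_nil, wordSingle_nil_nil, one_mul]
  | cons a w =>
    rw [wordConv_cons, wordSingle_nil_nil, one_mul]
    simp [wordConv, wordSingle_nil_cons]

theorem wordConv_wordSingle_singleton_nil {T R : Type*} [CommRing R] (t : T) (f : List T → R) :
    wordConv (wordSingle R [t]) f [] = 0 := by
  rw [wordConv_nil, wordSingle_cons_nil, zero_mul]

open Classical in
theorem wordConv_wordSingle_singleton_cons {T R : Type*} [CommRing R] (t a : T) (f : List T → R)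
    (w : List T) : wordConv (wordSingle R [t]) f (a :: w) = if a = t then f w else 0 := by
  rw [wordConv_cons, wordSingle_cons_nil, zero_mul, zero_add]
  simp only [wordSingle_cons_cons]
  split_ifs with h
  · rw [← congrFun (wordConv_wordSingle_nil f) w]
  · simp [wordConv]

namespace ParseForest

variable {T : Type*} {g : ContextFreeGrammar T}

/-- The number of applications of rules in a sequence of parse trees. -/
def size : {α : List (Symbol T g.NT)} → ParseForest g α → ℕ
  | _, .nil => 0
  | _, .leaf _ rest => rest.size
  | _, .node _ _ _ children rest => children.size + rest.size + 1

theorem eq_nil (F : ParseForest g []) : F = .nil := by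
  cases F
  rfl

/-- A nonempty sequence of trees consists of its first tree and of the remaining trees. -/
def consEquiv (A : g.NT) (α : List (Symbol T g.NT)) :
    ParseForest g (.nonterminal A :: α) ≃ ParseForest g [.nonterminal A] × ParseForest g α where
  toFun
    | .node _ β mem children rest => (.node A β mem children .nil, rest)
  invFun
    | (.node _ β mem children _, rest) => .node A β mem children rest
  left_inv F := by cases F; rfl
  right_inv := by
    rintro ⟨F, G⟩
    cases F with
    | node A β mem children rest =>
      cases rest
      rfl

theorem yield_consEquiv_symm {A : g.NT} {α : List (Symbol T g.NT)}
    (F : ParseForest g [.nonterminal A]) (G : ParseForest g α) :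
    ((consEquiv A α).symm (F, G)).yield = F.yield ++ G.yield := by
  cases F with
  | node A β mem children rest =>
    cases rest
    simp [consEquiv, yield]

theorem size_consEquiv_symm {A : g.NT} {α : List (Symbol T g.NT)}
    (F : ParseForest g [.nonterminal A]) (G : ParseForest g α) :
    ((consEquiv A α).symm (F, G)).size = F.size + G.size := by
  cases F with
  | node A β mem children rest =>
    cases rest
    simp only [consEquiv, size, Equiv.coe_fn_symm_mk]
    omega

theorem exists_append {α δ : List (Symbol T g.NT)} (F : ParseForest g α) (G : ParseForest g δ) :
    ∃ H : ParseForest g (α ++ δ), H.yield = F.yield ++ G.yield ∧ G.size ≤ H.size := by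
  induction F with
  | nil => exact ⟨G, rfl, le_rfl⟩
  | leaf t rest ih =>
    obtain ⟨H, hy, hs⟩ := ih
    exact ⟨.leaf t H, by simp [yield, hy], hs⟩
  | node A β mem children rest _ ih =>
    obtain ⟨H, hy, hs⟩ := ih
    exact ⟨.node A β mem children H, by simp [yield, hy], by simp only [size]; omega⟩

/-- The sequences of parse trees with roots `α` and with a given yield. -/
def withYield (g : ContextFreeGrammar T) (α : List (Symbol T g.NT)) (w : List T) :
    Set (ParseForest g α) :=
  {F | F.yield = w}

theorem finite_withYield_nil (w : List T) : (withYield g [] w).Finite :=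
  (Set.finite_singleton .nil).subset fun F _ => F.eq_nil

theorem ncard_withYield_nil (R : Type*) [CommRing R] (w : List T) :
    ((withYield g [] w).ncard : R) = wordSingle R [] w := by
  cases w with
  | nil =>
    have : withYield g [] [] = {.nil} := by
      ext F
      simp [F.eq_nil, withYield, yield]
    rw [this, Set.ncard_singleton, wordSingle_nil_nil, Nat.cast_one]
  | cons a w =>
    have : withYield g [] (a :: w) = ∅ := by
      ext F
      simp [F.eq_nil, withYield, yield]
    rw [this, Set.ncard_empty, wordSingle_nil_cons, Nat.cast_zero]

theorem leaf_injective (t : T) (α : List (Symbol T g.NT)) :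
    Function.Injective (leaf t : ParseForest g α → ParseForest g (.terminal t :: α)) := by
  intro F G h
  injection h

theorem withYield_terminal_cons (t : T) (α : List (Symbol T g.NT)) (w : List T) :
    withYield g (.terminal t :: α) (t :: w) = leaf t '' withYield g α w := by
  ext F
  cases F with
  | leaf t F => simp [withYield, yield, (leaf_injective t α).eq_iff]

theorem withYield_terminal_of_ne (t : T) (α : List (Symbol T g.NT)) {w : List T}
    (h : ∀ v, w ≠ t :: v) : withYield g (.terminal t :: α) w = ∅ := by
  ext F
  cases F with
  | leaf t F => simpa [withYield, yield] using fun h' => h _ h'.symm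

theorem finite_withYield_terminal {t : T} {α : List (Symbol T g.NT)}
    (h : ∀ w, (withYield g α w).Finite) (w : List T) :
    (withYield g (.terminal t :: α) w).Finite := by
  by_cases hw : ∃ v, w = t :: v
  · obtain ⟨v, rfl⟩ := hw
    rw [withYield_terminal_cons]
    exact (h v).image _
  · rw [withYield_terminal_of_ne t α (not_exists.mp hw)]
    exact Set.finite_empty

theorem ncard_withYield_terminal (R : Type*) [CommRing R] (t : T) (α : List (Symbol T g.NT))
    (w : List T) : ((withYield g (.terminal t :: α) w).ncard : R) =
      wordConv (wordSingle R [t]) (fun v => ((withYield g α v).ncard : R)) w := by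
  cases w with
  | nil => rw [wordConv_wordSingle_singleton_nil, withYield_terminal_of_ne t α (by simp),
      Set.ncard_empty, Nat.cast_zero]
  | cons a w =>
    rw [wordConv_wordSingle_singleton_cons]
    split_ifs with h
    · rw [h, withYield_terminal_cons, Set.ncard_image_of_injective _ (leaf_injective t α)]
    · rw [withYield_terminal_of_ne t α (by simp [h]), Set.ncard_empty, Nat.cast_zero]

/-- A sequence of trees with a given yield is determined by the position that splits the yield, by
its first tree and by the remaining trees. -/
noncomputable def withYieldConsEquiv (A : g.NT) (α : List (Symbol T g.NT)) (w : List T) :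
    (Σ i : Fin (w.length + 1),
      withYield g [.nonterminal A] (w.take i) × withYield g α (w.drop i)) ≃
      withYield g (.nonterminal A :: α) w :=
  Equiv.ofBijective
    (fun p => ⟨(consEquiv A α).symm (p.2.1.1, p.2.2.1), by
      obtain ⟨i, ⟨F, hF⟩, ⟨G, hG⟩⟩ := p
      have hF' : F.yield = w.take i := hF
      have hG' : G.yield = w.drop i := hG
      change yield _ = w
      rw [yield_consEquiv_symm, hF', hG', List.take_append_drop]⟩) <| by
    constructor
    · rintro ⟨i, ⟨F, hF⟩, ⟨G, hG⟩⟩ ⟨i', ⟨F', hF'⟩, ⟨G', hG'⟩⟩ h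
      have h1 := (consEquiv A α).symm.injective (Subtype.ext_iff.mp h)
      simp only [Prod.mk.injEq] at h1
      obtain ⟨rfl, rfl⟩ := h1
      have h2 : w.take i = w.take i' := Eq.trans (Eq.symm hF) hF'
      have h3 := congrArg List.length h2
      simp only [List.length_take] at h3
      obtain rfl : i = i' := by
        ext
        omega
      rfl
    · rintro ⟨H, hH⟩
      obtain ⟨⟨F, G⟩, rfl⟩ := (consEquiv A α).symm.surjective H
      have hw : F.yield ++ G.yield = w := by
        rw [← yield_consEquiv_symm]
        exact hH
      subst hw
      refine ⟨⟨⟨F.yield.length, ?_⟩, ⟨F, List.take_left.symm⟩, ⟨G, List.drop_left.symm⟩⟩, rfl⟩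
      rw [List.length_append]
      omega

theorem finite_withYield_nonterminal {A : g.NT} {α : List (Symbol T g.NT)}
    (hA : ∀ w, (withYield g [.nonterminal A] w).Finite) (hα : ∀ w, (withYield g α w).Finite)
    (w : List T) : (withYield g (.nonterminal A :: α) w).Finite := by
  have h1 : ∀ w, Finite (withYield g [.nonterminal A] w) := fun w => (hA w).to_subtype
  have h2 : ∀ w, Finite (withYield g α w) := fun w => (hα w).to_subtype
  have := Finite.of_equiv _ (withYieldConsEquiv A α w)
  exact Set.toFinite _

theorem ncard_withYield_nonterminal (R : Type*) [CommRing R] {A : g.NT}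
    {α : List (Symbol T g.NT)} (hA : ∀ w, (withYield g [.nonterminal A] w).Finite)
    (hα : ∀ w, (withYield g α w).Finite) (w : List T) :
    ((withYield g (.nonterminal A :: α) w).ncard : R) =
      wordConv (fun v => ((withYield g [.nonterminal A] v).ncard : R))
        (fun v => ((withYield g α v).ncard : R)) w := by
  have h1 : ∀ w, Finite (withYield g [.nonterminal A] w) := fun w => (hA w).to_subtype
  have h2 : ∀ w, Finite (withYield g α w) := fun w => (hα w).to_subtype
  rw [← Nat.card_coe_set_eq, ← Nat.card_congr (withYieldConsEquiv A α w), Nat.card_sigma]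
  simp only [Nat.card_prod, Nat.card_coe_set_eq, Nat.cast_sum, Nat.cast_mul]
  rw [wordConv, Finset.sum_range]

end ParseForest

/-! ### The regular system of a grammar. -/

namespace ContextFreeGrammar

open ParseForest

variable {T : Type*} (g : ContextFreeGrammar T)

/-- The nonterminals that have parse trees, but only finitely many for each word. -/
def finitaryNonterminals : Set g.NT :=
  {A | (∀ w, (withYield g [.nonterminal A] w).Finite) ∧
    Nonempty (ParseForest g [.nonterminal A])}

variable {g}

theorem exists_rule_of_parseForest {A : g.NT} (F : ParseForest g [.nonterminal A]) :
    ∃ β, ContextFreeRule.mk A β ∈ g.rules := by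
  cases F with
  | node A β mem _ _ => exact ⟨β, mem⟩

variable (g) in
-- The type of nonterminals may be infinite, but each of these is the left side of one of finitely
-- many rules.
theorem finite_finitaryNonterminals : g.finitaryNonterminals.Finite := by
  refine (g.rules.finite_toSet.image ContextFreeRule.input).subset ?_
  rintro A ⟨-, ⟨F⟩⟩
  obtain ⟨β, hβ⟩ := exists_rule_of_parseForest F
  exact ⟨_, hβ, rfl⟩

/-- With the other trees of `F` kept fixed, the trees with root `B` and a given yield embed into the
forests over `β` with one yield, of which there are finitely many. -/
theorem mem_finitaryNonterminals_of_mem {β : List (Symbol T g.NT)}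
    (hβ : ∀ w, (withYield g β w).Finite) (F : ParseForest g β) {B : g.NT}
    (hB : .nonterminal B ∈ β) : B ∈ g.finitaryNonterminals := by
  induction β with
  | nil => simp at hB
  | cons X β ih =>
    cases X with
    | terminal t =>
      cases F with
      | leaf t F =>
        refine ih (fun w => ?_) F (by simpa using hB)
        have := hβ (t :: w)
        rw [withYield_terminal_cons] at this
        exact this.of_finite_image (leaf_injective t β).injOn
    | nonterminal A =>
      obtain ⟨⟨F, G⟩, rfl⟩ := (consEquiv A β).symm.surjective F
      rcases List.mem_cons.mp hB with h | h
      · obtain rfl : B = A := by simpa using h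
        refine ⟨fun w => ?_, ⟨F⟩⟩
        refine Set.Finite.of_finite_image (f := fun H => (consEquiv B β).symm (H, G))
          ((hβ (w ++ G.yield)).subset ?_) ?_
        · rintro _ ⟨H, hH, rfl⟩
          have hH' : H.yield = w := hH
          change yield _ = _
          rw [yield_consEquiv_symm, hH']
        · intro H _ H' _ h
          exact (Prod.mk.inj ((consEquiv B β).symm.injective h)).1
      · refine ih (fun w => ?_) G h
        refine Set.Finite.of_finite_image (f := fun H => (consEquiv A β).symm (F, H))
          ((hβ (F.yield ++ w)).subset ?_) ?_
        · rintro _ ⟨H, hH, rfl⟩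
          have hH' : H.yield = w := hH
          change yield _ = _
          rw [yield_consEquiv_symm, hH']
        · intro H _ H' _ h
          exact (Prod.mk.inj ((consEquiv A β).symm.injective h)).2

theorem finite_withYield_output {A : g.NT} (hA : ∀ w, (withYield g [.nonterminal A] w).Finite)
    {β : List (Symbol T g.NT)} (h : ContextFreeRule.mk A β ∈ g.rules) (w : List T) :
    (withYield g β w).Finite := by
  refine Set.Finite.of_finite_image (f := fun F => ParseForest.node A β h F .nil)
    ((hA w).subset ?_) ?_
  · rintro _ ⟨F, hF, rfl⟩
    have hF' : F.yield = w := hF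
    change yield _ = _
    simp [yield, hF']
  · intro F _ G _ h
    injection h

/-- The inclusion of the symbols over a set of nonterminals. -/
def symbolInclusion {N : Type*} (U : Set N) : Symbol T U → Symbol T N
  | .terminal t => .terminal t
  | .nonterminal A => .nonterminal A

theorem symbolInclusion_injective {N : Type*} (U : Set N) :
    Function.Injective (symbolInclusion (T := T) U) := by
  rintro (t | A) (t' | A') h
  · simpa [symbolInclusion] using h
  · simp [symbolInclusion] at h
  · simp [symbolInclusion] at h
  · simpa [symbolInclusion, Subtype.ext_iff] using h

theorem exists_map_symbolInclusion_eq {N : Type*} {U : Set N} {β : List (Symbol T N)}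
    (h : ∀ B, .nonterminal B ∈ β → B ∈ U) : ∃ γ : List (Symbol T U), γ.map (symbolInclusion U) = β := by
  induction β with
  | nil => exact ⟨[], rfl⟩
  | cons X β ih =>
    obtain ⟨γ, rfl⟩ := ih fun B hB => h B (List.mem_cons_of_mem _ hB)
    cases X with
    | terminal t => exact ⟨.terminal t :: γ, rfl⟩
    | nonterminal A => exact ⟨.nonterminal ⟨A, h A List.mem_cons_self⟩ :: γ, rfl⟩

variable (g) in
/-- The number of parse trees of a word. -/
noncomputable def treeSeries (R : Type*) [CommRing R] (A : g.finitaryNonterminals) (w : List T) :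
    R :=
  ((withYield g [.nonterminal A.1] w).ncard : R)

theorem finite_withYield_map (β : List (Symbol T g.finitaryNonterminals)) (w : List T) :
    (withYield g (β.map (symbolInclusion _)) w).Finite := by
  induction β generalizing w with
  | nil => exact finite_withYield_nil w
  | cons X β ih =>
    cases X with
    | terminal t => exact finite_withYield_terminal ih w
    | nonterminal A => exact finite_withYield_nonterminal A.2.1 ih w

theorem formSeries_treeSeries (R : Type*) [CommRing R]
    (β : List (Symbol T g.finitaryNonterminals)) (w : List T) :
    formSeries (g.treeSeries R) β w =
      ((withYield g (β.map (symbolInclusion _)) w).ncard : R) := by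
  induction β generalizing w with
  | nil => exact (ncard_withYield_nil R w).symm
  | cons X β ih =>
    rw [formSeries, funext ih]
    cases X with
    | terminal t => exact (ncard_withYield_terminal R t _ w).symm
    | nonterminal A =>
      exact (ncard_withYield_nonterminal R A.2.1 (finite_withYield_map β) w).symm

variable (g) in
/-- The right-hand sides of the rules for a nonterminal in which all nonterminals are finitary. -/
noncomputable def finitaryRules (A : g.finitaryNonterminals) :
    Finset (List (Symbol T g.finitaryNonterminals)) :=
  g.rules.preimage (fun β => ⟨A.1, β.map (symbolInclusion _)⟩) fun _ _ _ _ h =>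
    (List.map_injective_iff.mpr (symbolInclusion_injective _)) (ContextFreeRule.mk.inj h).2

theorem mem_finitaryRules {A : g.finitaryNonterminals}
    {β : List (Symbol T g.finitaryNonterminals)} :
    β ∈ g.finitaryRules A ↔
      ContextFreeRule.mk A.1 (β.map (symbolInclusion _)) ∈ g.rules := by
  exact Finset.mem_preimage

/-- A parse tree is determined by the rule applied to its root and by the subtrees. -/
noncomputable def withYieldNodeEquiv (A : g.finitaryNonterminals) (w : List T) :
    (Σ β : g.finitaryRules A, withYield g (β.1.map (symbolInclusion _)) w) ≃
      withYield g [.nonterminal A.1] w :=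
  Equiv.ofBijective (fun p => ⟨.node A.1 _ (mem_finitaryRules.mp p.1.2) p.2.1 .nil, by
      obtain ⟨_, ⟨F, hF⟩⟩ := p
      have hF' : F.yield = w := hF
      change yield _ = w
      simp [yield, hF']⟩) <| by
    constructor
    · rintro ⟨⟨β, hβ⟩, ⟨F, hF⟩⟩ ⟨⟨γ, hγ⟩, ⟨G, hG⟩⟩ h
      have h1 := Subtype.ext_iff.mp h
      simp only [ParseForest.node.injEq] at h1
      obtain rfl : β = γ :=
        (List.map_injective_iff.mpr (symbolInclusion_injective _)) h1.1
      obtain rfl := eq_of_heq h1.2.1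
      rfl
    · rintro ⟨F, hF⟩
      cases F with
      | node _ β mem F rest =>
        obtain ⟨γ, rfl⟩ := exists_map_symbolInclusion_eq fun B hB =>
          mem_finitaryNonterminals_of_mem (finite_withYield_output A.2.1 mem) F hB
        cases rest
        refine ⟨⟨⟨γ, mem_finitaryRules.mpr mem⟩, ⟨F, ?_⟩⟩, rfl⟩
        simpa [withYield, yield] using hF

theorem treeSeries_eq (R : Type*) [CommRing R] (A : g.finitaryNonterminals) (w : List T) :
    g.treeSeries R A w = ∑ β ∈ g.finitaryRules A, formSeries (g.treeSeries R) β w := by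
  have h : ∀ β : g.finitaryRules A, Finite (withYield g (β.1.map (symbolInclusion _)) w) :=
    fun β => (finite_withYield_map β.1 w).to_subtype
  simp only [formSeries_treeSeries]
  rw [treeSeries, ← Nat.card_coe_set_eq, ← Nat.card_congr (withYieldNodeEquiv A w),
    Nat.card_sigma, Nat.cast_sum]
  simp only [Nat.card_coe_set_eq]
  exact Finset.sum_coe_sort (g.finitaryRules A)
    fun β => ((withYield g (β.map (symbolInclusion _)) w).ncard : R)

/-- The greatest size of a parse tree of a word. -/
noncomputable def maxSize (A : g.finitaryNonterminals) (w : List T) : ℕ :=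
  (A.2.1 w).toFinset.sup ParseForest.size

/-- Surround the given tree by forests with empty yield and apply the rule at a new root: the yield
stays and the size grows. -/
theorem exists_size_lt {A B : g.finitaryNonterminals}
    {α γ : List (Symbol T g.finitaryNonterminals)} (h : α ++ .nonterminal B :: γ ∈ g.finitaryRules A)
    (hα : (withYield g (α.map (symbolInclusion _)) []).Nonempty)
    (hγ : (withYield g (γ.map (symbolInclusion _)) []).Nonempty) {w : List T}
    {F : ParseForest g [.nonterminal B.1]} (hF : F ∈ withYield g _ w) :
    ∃ G ∈ withYield g [.nonterminal A.1] w, F.size < G.size := by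
  obtain ⟨Fα, hFα⟩ := hα
  obtain ⟨Fγ, hFγ⟩ := hγ
  obtain ⟨H, hy, hs⟩ := exists_append Fα ((consEquiv B.1 _).symm (F, Fγ))
  rw [yield_consEquiv_symm, show Fα.yield = [] from hFα, show Fγ.yield = [] from hFγ,
    show F.yield = w from hF, List.append_nil, List.nil_append] at hy
  rw [size_consEquiv_symm] at hs
  rw [mem_finitaryRules, List.map_append, List.map_cons] at h
  refine ⟨.node A.1 _ h H .nil, ?_, ?_⟩
  · change yield _ = w
    exact (List.append_nil _).trans hy
  · change _ < H.size + 0 + 1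
    omega

theorem maxSize_le {A B : g.finitaryNonterminals} {w : List T}
    (h : ∀ F ∈ withYield g [.nonterminal B.1] w,
      ∃ G ∈ withYield g [.nonterminal A.1] w, F.size < G.size) : maxSize B w ≤ maxSize A w := by
  refine Finset.sup_le fun F hF => ?_
  obtain ⟨G, hG, hlt⟩ := h F ((Set.Finite.mem_toFinset _).mp hF)
  exact hlt.le.trans (Finset.le_sup (f := ParseForest.size) ((Set.Finite.mem_toFinset _).mpr hG))

theorem maxSize_lt {A B : g.finitaryNonterminals} {w : List T}
    (hw : (withYield g [.nonterminal B.1] w).Nonempty)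
    (h : ∀ F ∈ withYield g [.nonterminal B.1] w,
      ∃ G ∈ withYield g [.nonterminal A.1] w, F.size < G.size) : maxSize B w < maxSize A w := by
  obtain ⟨F, hF, hsup⟩ := Finset.exists_mem_eq_sup (B.2.1 w).toFinset
    ((Set.Finite.toFinset_nonempty _).mpr hw) ParseForest.size
  obtain ⟨G, hG, hlt⟩ := h F ((Set.Finite.mem_toFinset _).mp hF)
  rw [maxSize, hsup]
  exact hlt.trans_le (Finset.le_sup (f := ParseForest.size) ((Set.Finite.mem_toFinset _).mpr hG))

/-- A word that is the yield of a parse tree with a given root. -/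
noncomputable def someYield (A : g.finitaryNonterminals) : List T :=
  A.2.2.some.yield

theorem withYield_someYield_nonempty (A : g.finitaryNonterminals) :
    (withYield g [.nonterminal A.1] (someYield A)).Nonempty :=
  ⟨A.2.2.some, rfl⟩

noncomputable instance : Fintype g.finitaryNonterminals :=
  g.finite_finitaryNonterminals.fintype

variable (g) in
/-- The system of equations for the numbers of parse trees. -/
noncomputable def regularSystem (R : Type*) [CommRing R] :
    RegularSystem T g.finitaryNonterminals R where
  rules := g.finitaryRules
  series := g.treeSeries R
  series_eq := treeSeries_eq R
  -- For a single word both maxima could be suprema of empty sets. Summing over one derivable word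
  -- per nonterminal forces a strict increase at the summand `C = B`.
  rank A := ∑ C : g.finitaryNonterminals, maxSize A (someYield C)
  rank_lt A α γ B h hα hγ := by
    have hne : ∀ β : List (Symbol T g.finitaryNonterminals),
        formSeries (g.treeSeries R) β [] ≠ 0 →
        (withYield g (β.map (symbolInclusion _)) []).Nonempty := by
      intro β hβ
      rw [formSeries_treeSeries] at hβ
      rw [Set.nonempty_iff_ne_empty]
      intro h0
      rw [h0, Set.ncard_empty, Nat.cast_zero] at hβ
      exact hβ rfl
    refine Finset.sum_lt_sum (fun C _ => ?_) ⟨B, Finset.mem_univ B, ?_⟩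
    · exact maxSize_le fun F hF => exists_size_lt h (hne α hα) (hne γ hγ) hF
    · exact maxSize_lt (withYield_someYield_nonempty B) fun F hF =>
        exists_size_lt h (hne α hα) (hne γ hγ) hF

end ContextFreeGrammar

/-! ### The language `{aⁿ bⁿ cⁿ | n ≥ 0}` -/

theorem one_add_eq_one_sub (y : MvPowerSeries (Fin 3) (ZMod 2)) : 1 + y = 1 - y := by
  ext m
  rw [map_add, map_sub, CharTwo.sub_eq_add]

theorem one_add_mul_diagonalSeries :
    (1 + MvPowerSeries.X 0 * MvPowerSeries.X 1 * MvPowerSeries.X 2) * diagonalSeries (ZMod 2) =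
      1 := by
  rw [one_add_eq_one_sub, one_sub_mul_diagonalSeries]

theorem sortedWord_mem_languageANBNCN_iff {T : Type*} {a b c : T} (hab : a ≠ b) (hac : a ≠ c)
    (hbc : b ≠ c) (m : Fin 3 →₀ ℕ) :
    sortedWord ![a, b, c] m ∈ languageANBNCN a b c ↔ m 0 = m 1 ∧ m 1 = m 2 := by
  classical
  constructor
  · rintro ⟨n, hn⟩
    have ha := congrArg (List.count a) hn
    have hb := congrArg (List.count b) hn
    have hc := congrArg (List.count c) hn
    simp [sortedWord, List.count_replicate, hab, hab.symm, hac, hac.symm, hbc, hbc.symm]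
      at ha hb hc
    omega
  · rintro ⟨h1, h2⟩
    refine ⟨m 2, ?_⟩
    simp [sortedWord, h1, h2]

theorem sortedPath_zero_two {m : Fin 3 →₀ ℕ} : SortedPath 0 2 m ↔ m 2 ≠ 0 := by
  simp only [SortedPath]
  constructor
  · exact fun h => h.2.2 (by decide)
  · exact fun h => ⟨by decide, fun j _ => ⟨Fin.zero_le j, by omega⟩, fun _ => h⟩

open Classical in
-- The entry `(0, 2)` sees only the words that end in `c`; the summand `1` restores the empty word,
-- the case `n = 0`.
theorem one_add_sortedSeries_eq_diagonalSeries {T R : Type*} [CommRing R] {a b c : T}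
    (hab : a ≠ b) (hac : a ≠ c) (hbc : b ≠ c) {f : List T → R}
    (hf : ∀ w, f w = if w ∈ languageANBNCN a b c then 1 else 0) :
    1 + sortedSeries ![a, b, c] f 0 2 = diagonalSeries R := by
  ext m
  rw [map_add, coeff_sortedSeries, coeff_diagonalSeries, MvPowerSeries.coeff_one, hf]
  simp only [sortedPath_zero_two, sortedWord_mem_languageANBNCN_iff hab hac hbc]
  have h0 : m = 0 ↔ m 0 = 0 ∧ m 1 = 0 ∧ m 2 = 0 := by
    rw [Finsupp.ext_iff]
    simp [Fin.forall_fin_succ]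
  simp only [h0]
  by_cases h2 : m 2 = 0
  · have hiff : (m 0 = 0 ∧ m 1 = 0) ↔ (m 0 = m 1 ∧ m 1 = 0) := by omega
    simp only [h2, and_true, hiff, ne_eq, not_true_eq_false, if_false, add_zero]
  · simp [h2]

theorem not_exists_gf2Grammar_languageANBNCN {T : Type*} {a b c : T} (hab : a ≠ b) (hac : a ≠ c)
    (hbc : b ≠ c) : ¬ ∃ G : GF2Grammar T, G.language = languageANBNCN a b c := by
  classical
  rintro ⟨G, hG⟩
  have hodd : ∀ w, Odd (G.ordinary.parseTrees w).ncard ↔ w ∈ languageANBNCN a b c := by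
    intro w
    rw [← hG]
    rfl
  have hS : G.ordinary.initial ∈ G.ordinary.finitaryNonterminals := by
    refine ⟨G.finite_parseTrees, ?_⟩
    -- The empty word is in the language, so the initial symbol has a parse tree.
    have hne : (G.ordinary.parseTrees []).ncard ≠ 0 := ((hodd []).mpr ⟨0, by simp⟩).pos.ne'
    obtain ⟨F, -⟩ := Set.nonempty_of_ncard_ne_zero hne
    exact ⟨F⟩
  let P := G.ordinary.regularSystem (ZMod 2)
  obtain ⟨p, hp, q, hq, r, hr, hp0, hq0, hr0, h⟩ := P.exists_mul_sortedSeries_zero_two_mem ![a, b, c]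
  have hseries : ∀ w, P.series ⟨_, hS⟩ w = if w ∈ languageANBNCN a b c then 1 else 0 := by
    intro w
    change ((G.ordinary.parseTrees w).ncard : ZMod 2) = _
    split_ifs with hw
    · exact ZMod.natCast_eq_one_iff_odd.mpr ((hodd w).mpr hw)
    · exact ZMod.natCast_eq_zero_iff_even.mpr (Nat.not_odd_iff_even.mp (mt (hodd w).mp hw))
  refine mul_diagonalSeries_notMem_separatedSpan hp hq hr hp0 hq0 hr0
    (univariateAlgebraic_sup_le_separatedSpan (ZMod 2) ?_)
  rw [← one_add_sortedSeries_eq_diagonalSeries hab hac hbc hseries, mul_add, mul_one]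
  refine Subalgebra.add_mem _ (polynomialsIn_le (s := Set.univ) (fun i _ => ?_)
    (mem_polynomialsIn.mpr ⟨p * q * r, by simp, rfl⟩)) (h _)
  fin_cases i
  · exact le_sup_left.trans le_sup_left
  · exact le_sup_right.trans le_sup_left
  · exact le_sup_right

theorem inv_one_add_notMem_Rabc :
    (algebraMap (MvPowerSeries (Fin 3) (ZMod 2)) (FractionRing (MvPowerSeries (Fin 3) (ZMod 2)))
      (1 + MvPowerSeries.X 0 * MvPowerSeries.X 1 * MvPowerSeries.X 2))⁻¹ ∉ Rabc := by
  rintro ⟨n, A, B, C, p, q, r, hA, hB, hC, hp, hq, hr, hp0, hq0, hr0, h⟩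
  refine mul_diagonalSeries_notMem_separatedSpan hp hq hr hp0 hq0 hr0 ?_
  have hinj := IsFractionRing.injective (MvPowerSeries (Fin 3) (ZMod 2))
    (FractionRing (MvPowerSeries (Fin 3) (ZMod 2)))
  have hden : ((p * q * r : MvPolynomial (Fin 3) (ZMod 2)) : MvPowerSeries (Fin 3) (ZMod 2)) ≠ 0 :=
    fun h0 => mul_ne_zero (mul_ne_zero hp0 hq0) hr0 (MvPolynomial.coe_eq_zero_iff.mp h0)
  have hone := one_add_mul_diagonalSeries
  have hunit := left_ne_zero_of_mul_eq_one hone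
  rw [inv_eq_one_div, div_eq_div_iff ((map_ne_zero_iff _ hinj).mpr hunit)
    ((map_ne_zero_iff _ hinj).mpr hden), one_mul, ← map_mul] at h
  have h' := hinj h
  -- Cross-multiplication gave `p q r = (∑ A B C)(1 + abc)`; multiplying by the diagonal series
  -- leaves the sum alone.
  rw [h', mul_assoc, hone, mul_one]
  refine Submodule.sum_mem _ fun i _ => Submodule.subset_span ?_
  obtain ⟨α, -, hα⟩ := hA i
  obtain ⟨β, -, hβ⟩ := hB i
  obtain ⟨γ, -, hγ⟩ := hC i
  exact ⟨α, β, γ, by rw [hα, hβ, hγ]; rfl⟩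

theorem theorem4p3 {T : Type*} (a b c : T) (hab : a ≠ b) (hac : a ≠ c) (hbc : b ≠ c) :
    (¬ ∃ G : GF2Grammar T, G.language = languageANBNCN a b c) ∧
    (algebraMap (MvPowerSeries (Fin 3) (ZMod 2)) (FractionRing (MvPowerSeries (Fin 3) (ZMod 2)))
      (1 + MvPowerSeries.X 0 * MvPowerSeries.X 1 * MvPowerSeries.X 2))⁻¹ ∉ Rabc :=
  ⟨not_exists_gf2Grammar_languageANBNCN hab hac hbc, inv_one_add_notMem_Rabc⟩
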